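/- Let $n\ge 1$ and let $V=\{x\in\mathbb{R}^{n+1} : x_1+\dots+x_{n+1}=0\}$ with the standard inner product $\langle\cdot,\cdot\rangle$. Let $\Phi=\{e_i-e_j : i\neq j\}\subset V$ be the root system of type $A_n$, with simple roots $\alpha_i=e_i-e_{i+1}$ $(1\le i\le n)$, positive roots $\Phi^+=\{e_i-e_j : i<j\}$, coroots $\alpha^\vee=2\alpha/\langle\alpha,\alpha\rangle$, and Weyl group $W$ generated by the reflections in the roots. Let $Q$ be the root lattice (the integer combinations of roots) and $P=\{v\in V : \langle v,\alpha^\vee\rangle\in\mathbb{Z}\text{ for all }\alpha\in\Phi\}$ the weight lattice. Let $\omega_1,\dots,\omega_n$ be the fundamental weights, given by $\langle\omega_i,\alpha_j^\vee\rangle=\delta_{ij}$, and $\rho=\omega_1+\dots+\omega_n$. For $\lambda\in P$ let $\Pi(\lambda)$ be the convex hull of the orbit $W\lambda$, let $\Pi^{Q}(\lambda)=\{\mu\in\Pi(\lambda):\lambda-\mu\in Q\}$, and let $\Pi^{\circ,Q}(\lambda)=\{\mu\in\Pi^{\circ}(\lambda):\lambda-\mu\in Q\}$, where $\Pi^{\circ}(\lambda)$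 is the topological interior of $\Pi(\lambda)$ in $V$. A weight $\omega\in P$ is minuscule if it is nonzero, dominant ($\langle\omega,\alpha_i^\vee\rangle\ge 0$ for all $i$), and $\Pi^Q(\omega)=W\omega$. Let $\Omega_m$ be the set of minuscule weights and $\Omega_m^0=\Omega_m\cup\{0\}$. A central-firing move replaces a weight $\lambda$ by $\lambda+\alpha$, where $\alpha\in\Phi^+$ satisfies $\langle\lambda,\alpha^\vee\rangle=0$. A weight $\lambda\in P$ is called connected if the vectors $\lambda-\mu$, where $\mu$ ranges over all weights reachable from $\lambda$ by finitely many (possibly zero) central-firing moves, span $V$ over $\mathbb{R}$. Then for every $\lambda\in P$ there is a unique $\omega\in\Omega_m^0$ with $\rho+\omega-\lambda\in Q$, and $\lambda$ is connected if and only if $\lambda\in\Pi^{\circ,Q}(\rho+\omega')$ for some $\omega'\in\Omega_m^0$; equivalently, if and only if $\lambda\in\Pi^{\circ,Q}(\rho+\omega)$ for this unique $\omega$. -/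

import Mathlib

open scoped RealInnerProductSpace

noncomputable section

section Euclidean

variable {V : Type*} [NormedAddCommGroup V] [InnerProductSpace ℝ V]

/-- The coroot `α^∨ = 2 α / ⟪α, α⟫` of a nonzero vector `α`. -/
def dualVector (α : V) : V := (2 / ⟪α, α⟫) • α

/-- The orthogonal reflection in the hyperplane orthogonal to `α`. -/
def rootReflection (α : V) : V ≃ₗᵢ[ℝ] V := (ℝ ∙ α)ᗮ.reflection

theorem innerₗ_nondegenerate : LinearMap.BilinForm.Nondegenerate (innerₗ V) :=
  ⟨fun x hx => inner_self_eq_zero.1 (hx x), fun x hx => inner_self_eq_zero.1 (hx x)⟩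

theorem rootReflection_apply (α v : V) :
    rootReflection α v = v - ⟪v, dualVector α⟫ • α := by
  rw [rootReflection, Submodule.reflection_orthogonal_apply, Submodule.reflection_singleton_apply,
    dualVector, inner_smul_right, real_inner_comm, real_inner_self_eq_norm_sq]
  simp only [RCLike.ofReal_real_eq_id, id_eq, neg_sub, two_smul, ← add_smul]
  congr 2
  ring

end Euclidean

/-- A (reduced, crystallographic) root system of rank `n` in a Euclidean space `V`, together with
a choice of simple roots. -/
structure BasedRootSystem (V : Type*) [NormedAddCommGroup V] [InnerProductSpace ℝ V] (n : ℕ) where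
  /-- the set of roots `Φ` -/
  roots : Set V
  finite : roots.Finite
  zero_notMem : (0 : V) ∉ roots
  span_eq_top : Submodule.span ℝ roots = ⊤
  reflection_image : ∀ α ∈ roots, rootReflection α '' roots = roots
  reduced : ∀ α ∈ roots, ((ℝ ∙ α : Submodule ℝ V) : Set V) ∩ roots = {α, -α}
  integral : ∀ α ∈ roots, ∀ β ∈ roots, ∃ k : ℤ, ⟪β, dualVector α⟫ = k
  /-- the simple roots `α_1, …, α_n` -/
  simple : Module.Basis (Fin n) ℝ V
  simple_mem : ∀ i, simple i ∈ roots
  pos_or_neg : ∀ α ∈ roots, ∃ c : Fin n → ℕ,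
    α = ∑ i, (c i : ℝ) • simple i ∨ -α = ∑ i, (c i : ℝ) • simple i

namespace BasedRootSystem

variable {V : Type*} [NormedAddCommGroup V] [InnerProductSpace ℝ V] {n : ℕ}
  (R : BasedRootSystem V n)

/-- The positive roots `Φ⁺`. -/
def posRoots : Set V :=
  {α | α ∈ R.roots ∧ ∃ c : Fin n → ℕ, α = ∑ i, (c i : ℝ) • R.simple i}

/-- The Weyl group `W`, generated by the reflections in the roots. -/
def weylGroup : Subgroup (V ≃ₗᵢ[ℝ] V) :=
  Subgroup.closure {s | ∃ α ∈ R.roots, s = rootReflection α}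

/-- The root lattice `Q`: all integer combinations of roots. -/
def rootLattice : AddSubgroup V := AddSubgroup.closure R.roots

/-- The weight lattice `P = {v | ⟪v, α^∨⟫ ∈ ℤ for all roots α}`. -/
def weightLattice : Set V :=
  {v | ∀ α ∈ R.roots, ∃ k : ℤ, ⟪v, dualVector α⟫ = k}

/-- The fundamental weight `ω_i`, determined by `⟪ω_i, α_j^∨⟫ = δ_ij`
(see `inner_fundamentalWeight`). -/
def fundamentalWeight (i : Fin n) : V :=
  (⟪R.simple i, R.simple i⟫ / 2) •
    LinearMap.BilinForm.dualBasis (innerₗ V) innerₗ_nondegenerate R.simple i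

theorem inner_fundamentalWeight (i j : Fin n) :
    ⟪R.fundamentalWeight i, dualVector (R.simple j)⟫ = if i = j then 1 else 0 := by
  have h := LinearMap.BilinForm.apply_dualBasis_left innerₗ_nondegenerate
    R.simple i j
  rw [innerₗ_apply_apply] at h
  have h0 : ⟪R.simple i, R.simple i⟫ ≠ 0 := inner_self_ne_zero.2 (R.simple.ne_zero i)
  rw [fundamentalWeight, dualVector, inner_smul_left, inner_smul_right, h]
  by_cases hij : i = j
  · subst hij
    simp only [if_true, RCLike.conj_to_real]
    field_simp
  · rw [if_neg (Ne.symm hij), if_neg hij]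
    simp

/-- The Weyl vector `ρ = ω_1 + ⋯ + ω_n`. -/
def weylVector : V := ∑ i, R.fundamentalWeight i

/-- Dominance: `⟪v, α_i^∨⟫ ≥ 0` for every simple root. -/
def IsDominant (v : V) : Prop := ∀ i, 0 ≤ ⟪v, dualVector (R.simple i)⟫

/-- The Weyl group orbit `W v`. -/
def weylOrbit (v : V) : Set V := {u | ∃ w ∈ R.weylGroup, u = w v}

/-- The permutohedron `Π(v)`: the convex hull of the Weyl group orbit of `v`. -/
def permutohedron (v : V) : Set V := convexHull ℝ (R.weylOrbit v)

/-- `Π^Q(v)`: the points of `Π(v)` congruent to `v` modulo the root lattice. -/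
def permutohedronPoints (v : V) : Set V :=
  {u | u ∈ R.permutohedron v ∧ v - u ∈ R.rootLattice}

/-- `Π^{∘,Q}(v)`: the points of the topological interior of `Π(v)` congruent to `v` modulo the
root lattice. -/
def interiorPoints (v : V) : Set V :=
  {u | u ∈ interior (R.permutohedron v) ∧ v - u ∈ R.rootLattice}

/-- The set `Ω_m` of minuscule weights: nonzero dominant weights `ω` such that `Π^Q(ω)` consists
of the Weyl group orbit of `ω` only. -/
def minusculeWeights : Set V :=
  {ω | ω ∈ R.weightLattice ∧ ω ≠ 0 ∧ R.IsDominant ω ∧ R.permutohedronPoints ω = R.weylOrbit ω}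

/-- `Ω_m ∪ {0}`. -/
def minusculeOrZero : Set V := R.minusculeWeights ∪ {0}

/-- One central-firing move: `v` becomes `v + α` for a positive root `α` orthogonal to `v`. -/
def CentralFires (v u : V) : Prop :=
  ∃ α ∈ R.posRoots, ⟪v, dualVector α⟫ = 0 ∧ u = v + α

/-- The firing span at `v`: the real span of all `v - u`, where `u` is reached from `v` by a finite
(possibly empty) sequence of central-firing moves. -/
def firingSpan (v : V) : Submodule ℝ V :=
  Submodule.span ℝ {d | ∃ u, Relation.ReflTransGen R.CentralFires v u ∧ d = v - u}

/-- A weight is connected if its firing span is the whole space. -/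
def IsConnectedWeight (v : V) : Prop := R.firingSpan v = ⊤

end BasedRootSystem

namespace TypeA

/-- The subspace of `ℝ^{n+1}` where the sum of the coordinates is zero. -/
def sumZero (n : ℕ) : Submodule ℝ (EuclideanSpace ℝ (Fin (n + 1))) where
  carrier := {x | ∑ i, x i = 0}
  add_mem' {x y} hx hy := by
    simp only [Set.mem_ofPred_eq, PiLp.add_apply, Finset.sum_add_distrib] at *
    rw [hx, hy, add_zero]
  zero_mem' := by simp
  smul_mem' c x hx := by
    simp only [Set.mem_ofPred_eq, PiLp.smul_apply, smul_eq_mul, ← Finset.mul_sum] at *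
    rw [hx, mul_zero]

variable {n : ℕ}

/-- The vector `e_i - e_j`. -/
def eSub (i j : Fin (n + 1)) : sumZero n :=
  ⟨EuclideanSpace.single i 1 - EuclideanSpace.single j 1, by
    change ∑ k, _ = _
    simp⟩

theorem eSub_apply (i j k : Fin (n + 1)) :
    (eSub i j : EuclideanSpace ℝ (Fin (n + 1))) k
      = (if k = i then 1 else 0) - (if k = j then 1 else 0) := by
  simp [eSub]

theorem ext_coord {x y : sumZero n}
    (h : ∀ k, (x : EuclideanSpace ℝ (Fin (n + 1))) k = (y : EuclideanSpace ℝ (Fin (n + 1))) k) :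
    x = y := by
  apply Subtype.ext
  ext k
  exact h k

theorem inner_eSub (x : sumZero n) (i j : Fin (n + 1)) :
    ⟪x, eSub i j⟫ = (x : EuclideanSpace ℝ (Fin (n + 1))) i
      - (x : EuclideanSpace ℝ (Fin (n + 1))) j := by
  rw [Submodule.coe_inner]
  simp [eSub, inner_sub_right, EuclideanSpace.inner_single_right]

theorem inner_dualVector_eSub (x : sumZero n) {i j : Fin (n + 1)} (hij : i ≠ j) :
    ⟪x, dualVector (eSub i j)⟫ = (x : EuclideanSpace ℝ (Fin (n + 1))) i
      - (x : EuclideanSpace ℝ (Fin (n + 1))) j := by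
  rw [dualVector, inner_smul_right, inner_eSub, inner_eSub, eSub_apply, eSub_apply]
  simp only [if_true, if_neg hij, if_neg hij.symm]
  norm_num

theorem rootReflection_eSub_apply (x : sumZero n) {i j : Fin (n + 1)} (hij : i ≠ j)
    (k : Fin (n + 1)) :
    (rootReflection (eSub i j) x : EuclideanSpace ℝ (Fin (n + 1))) k
      = (x : EuclideanSpace ℝ (Fin (n + 1))) (Equiv.swap i j k) := by
  rw [rootReflection_apply, inner_dualVector_eSub x hij]
  simp only [Submodule.coe_sub, Submodule.coe_smul, PiLp.sub_apply, PiLp.smul_apply, eSub_apply,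
    smul_eq_mul]
  by_cases hi : k = i
  · subst hi; simp [hij]
  by_cases hj : k = j
  · subst hj; simp [hi]
  · simp [hi, hj, Equiv.swap_apply_of_ne_of_ne]

/-- The roots of `A_n`: the vectors `e_i - e_j` with `i ≠ j`. -/
def rootSet (n : ℕ) : Set (sumZero n) := {v | ∃ i j, i ≠ j ∧ v = eSub i j}

theorem neg_eSub (i j : Fin (n + 1)) : -eSub i j = eSub j i := by
  apply Subtype.ext; simp [eSub]

theorem eSub_add (i j k : Fin (n + 1)) : eSub i j + eSub j k = eSub i k := by
  apply Subtype.ext; simp [eSub]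

theorem eSub_self (i : Fin (n + 1)) : eSub i i = 0 := by
  apply Subtype.ext; simp [eSub]

theorem rootReflection_mem {α β : sumZero n} (hα : α ∈ rootSet n) (hβ : β ∈ rootSet n) :
    rootReflection α β ∈ rootSet n := by
  obtain ⟨i, j, hij, rfl⟩ := hα
  obtain ⟨k, l, hkl, rfl⟩ := hβ
  refine ⟨Equiv.swap i j k, Equiv.swap i j l, by simpa using hkl, ext_coord fun m => ?_⟩
  rw [rootReflection_eSub_apply _ hij, eSub_apply, eSub_apply]
  simp only [Equiv.swap_apply_eq_iff]

theorem eSub_pos (i j : Fin (n + 1)) (hij : i ≤ j) :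
    ∃ c : Fin n → ℕ, eSub i j = ∑ k, (c k : ℝ) • eSub k.castSucc k.succ := by
  induction j using Fin.induction with
  | zero =>
    obtain rfl : i = 0 := le_antisymm hij (Fin.zero_le _)
    exact ⟨0, by simp [eSub_self]⟩
  | succ j ih =>
    rcases hij.eq_or_lt with rfl | h
    · exact ⟨0, by simp [eSub_self]⟩
    · obtain ⟨c, hc⟩ := ih (Fin.le_castSucc_iff.2 h)
      refine ⟨c + Pi.single j 1, ?_⟩
      rw [← eSub_add i j.castSucc j.succ, hc]
      simp [add_smul, Finset.sum_add_distrib, Pi.single_apply]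

theorem eSub_mem_span (i j : Fin (n + 1)) :
    eSub i j ∈ Submodule.span ℝ (Set.range fun k : Fin n => eSub k.castSucc k.succ) := by
  have key : ∀ i j : Fin (n + 1), i ≤ j →
      eSub i j ∈ Submodule.span ℝ (Set.range fun k : Fin n => eSub k.castSucc k.succ) := by
    intro i j hij
    obtain ⟨c, hc⟩ := eSub_pos i j hij
    rw [hc]
    exact Submodule.sum_mem _ fun k _ =>
      Submodule.smul_mem _ _ (Submodule.subset_span ⟨k, rfl⟩)
  rcases le_total i j with h | h
  · exact key i j h
  · rw [← neg_eSub]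
    exact Submodule.neg_mem _ (key j i h)

theorem span_simple :
    ⊤ ≤ Submodule.span ℝ (Set.range fun k : Fin n => eSub k.castSucc k.succ) := by
  intro x _
  have hx : ∑ k, (x : EuclideanSpace ℝ (Fin (n + 1))) k = 0 := x.2
  have h : x = ∑ k, (x : EuclideanSpace ℝ (Fin (n + 1))) k • eSub k 0 := by
    apply ext_coord
    intro m
    simp [eSub_apply, mul_sub, Finset.sum_sub_distrib, hx]
  rw [h]
  exact Submodule.sum_mem _ fun k _ => Submodule.smul_mem _ _ (eSub_mem_span _ _)

theorem linearIndependent_simple :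
    LinearIndependent ℝ fun k : Fin n => (eSub k.castSucc k.succ : sumZero n) := by
  rw [Fintype.linearIndependent_iff]
  intro c hc
  have h : ∀ m : Fin (n + 1),
      ∑ k, c k * ((if m = k.castSucc then 1 else 0) - (if m = k.succ then 1 else 0)) = 0 := by
    intro m
    have := congrArg (fun x : sumZero n => (x : EuclideanSpace ℝ (Fin (n + 1))) m) hc
    simpa [eSub_apply] using this
  intro i
  have hs : ∑ m ∈ Finset.Iic i.castSucc,
      ∑ k, c k * ((if m = k.castSucc then 1 else 0) - (if m = k.succ then 1 else 0)) = 0 :=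
    Finset.sum_eq_zero fun m _ => h m
  rw [Finset.sum_comm] at hs
  simp only [← Finset.mul_sum, Finset.sum_sub_distrib, Finset.sum_ite_eq', Finset.mem_Iic] at hs
  rw [Finset.sum_eq_single i] at hs
  · simpa [Fin.le_def] using hs
  · intro k _ hk
    have hk' : (k : ℕ) ≠ i := fun e => hk (Fin.ext e)
    simp only [Fin.le_def, Fin.val_castSucc, Fin.val_succ]
    rcases lt_or_gt_of_ne hk' with h1 | h1
    · rw [if_pos h1.le, if_pos (by omega)]; ring
    · rw [if_neg (by omega), if_neg (by omega)]; ring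
  · simp

/-- The simple roots `e_i - e_{i+1}` of `A_n`, as a basis. -/
def simpleBasis (n : ℕ) : Module.Basis (Fin n) ℝ (sumZero n) :=
  Module.Basis.mk linearIndependent_simple span_simple

theorem simpleBasis_apply (k : Fin n) : simpleBasis n k = eSub k.castSucc k.succ := by
  simp [simpleBasis]

end TypeA

open TypeA in
/-- The root system `A_n` in the sum-zero subspace of `ℝ^{n+1}`: the roots are `e_i - e_j` for
`i ≠ j`, the simple roots are `e_i - e_{i+1}`. -/
def typeA (n : ℕ) : BasedRootSystem (sumZero n) n where
  roots := rootSet n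
  finite := by
    refine (Set.finite_range fun p : Fin (n + 1) × Fin (n + 1) => eSub p.1 p.2).subset ?_
    rintro _ ⟨i, j, -, rfl⟩
    exact ⟨(i, j), rfl⟩
  zero_notMem := by
    rintro ⟨i, j, hij, h⟩
    have := congrArg (fun x : sumZero n => (x : EuclideanSpace ℝ (Fin (n + 1))) i) h
    simp [eSub_apply, hij] at this
  span_eq_top := by
    refine top_le_iff.1 (span_simple.trans (Submodule.span_mono ?_))
    rintro _ ⟨k, rfl⟩
    exact ⟨_, _, Fin.castSucc_lt_succ.ne, rfl⟩
  reflection_image := by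
    intro α hα
    apply Set.Subset.antisymm
    · rintro _ ⟨β, hβ, rfl⟩
      exact rootReflection_mem hα hβ
    · intro β hβ
      exact ⟨rootReflection α β, rootReflection_mem hα hβ, by simp [rootReflection]⟩
  reduced := by
    rintro _ ⟨i, j, hij, rfl⟩
    ext v
    constructor
    · rintro ⟨hv, k, l, hkl, rfl⟩
      obtain ⟨c, hc⟩ := Submodule.mem_span_singleton.1 hv
      have hi := congrArg (fun x : sumZero n => (x : EuclideanSpace ℝ (Fin (n + 1))) i) hc
      have hk := congrArg (fun x : sumZero n => (x : EuclideanSpace ℝ (Fin (n + 1))) k) hc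
      simp only [Submodule.coe_smul, PiLp.smul_apply, eSub_apply, if_true, if_neg hij,
        if_neg hkl, smul_eq_mul] at hi hk
      have : c = 1 ∨ c = -1 := by
        split_ifs at hi hk <;>
          first
            | (left; linarith)
            | (right; linarith)
      rw [← hc]
      rcases this with rfl | rfl
      · left; simp
      · right; simp
    · rintro (rfl | rfl)
      · exact ⟨Submodule.mem_span_singleton_self _, i, j, hij, rfl⟩
      · exact ⟨Submodule.neg_mem _ (Submodule.mem_span_singleton_self _), j, i, hij.symm,
          neg_eSub i j⟩
  integral := by
    rintro _ ⟨i, j, hij, rfl⟩ _ ⟨k, l, hkl, rfl⟩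
    refine ⟨((if i = k then 1 else 0) - (if i = l then 1 else 0))
      - ((if j = k then 1 else 0) - (if j = l then 1 else 0)), ?_⟩
    rw [inner_dualVector_eSub _ hij, eSub_apply, eSub_apply]
    push_cast
    rfl
  simple := simpleBasis n
  simple_mem := by
    intro k
    rw [simpleBasis_apply]
    exact ⟨_, _, Fin.castSucc_lt_succ.ne, rfl⟩
  pos_or_neg := by
    rintro _ ⟨i, j, -, rfl⟩
    simp only [simpleBasis_apply]
    rcases le_total i j with h | h
    · obtain ⟨c, hc⟩ := eSub_pos i j h
      exact ⟨c, Or.inl hc⟩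
    · obtain ⟨c, hc⟩ := eSub_pos j i h
      exact ⟨c, Or.inr (by rw [neg_eSub, hc])⟩

end

/-! ### Coordinates for the lattices, the Weyl group and `ρ`. -/

namespace TypeA

variable {n : ℕ}

/-! In coordinates a weight is `t + z` with `z` an integer vector, and a central-firing move takes
two equal entries, raises the one with the smaller index by one and lowers the other by one. The
weights `ρ + ω` are the staircases `0, -1, …, -n` with the first `m ≤ n` entries raised by one,
shifted to sum zero; the residue `m` modulo `n + 1` indexes the cosets of `Q` in `P`, which gives
the unique `ω`. By Rado's theorem the interior of `Π(ρ + ω)` consists of the `t + z` with `∑_{S} z <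
R(|S|)` for all nonempty proper `S`, where `R` is the sequence of partial sums of the staircase
(`mem_interior_permutohedron_iff`).

Connected implies interior: `R` is strictly concave. If some proper `S` violates the inequality,
raise `R` at the sizes `1, …, n` by the largest excess. The new bound is still strictly concave,
holds for every set, and is tight at some proper `T`. A tight set never separates two equal entries,
since otherwise dropping one or adding the other would break the bound. So every move fires inside
or outside `T`, the sum over `T` never changes, and the firing span lies in a hyperplane
(`not_isConnectedWeight_of_sum_eq`, `sum_lt_of_isConnectedWeight`).

Interior implies connected: call two labels linked if `e_i - e_j` is in the firing span; labels that
ever share a value are linked. If the span is not everything, an unlinked pair at minimal distance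
cuts the labels into an upper set `A` and a lower set. The two labels facing each other across the
cut can never meet, so `A` stays on top with constant sum (`exists_separated_of_reachable`). Firing
can be run until all entries are distinct (`exists_reachable_injective`). For distinct integers with
the total of the staircase, an upper set of size `k` has sum at least `R(k)`
(`sum_raisedStair_le_of_injective`), against the strict inequality for `A`. -/

theorem sum_coord (x : sumZero n) : ∑ k, x.1 k = 0 := x.2

theorem eq_sum_smul_eSub (x : sumZero n) : x = ∑ k, x.1 k • eSub k 0 := by
  apply ext_coord
  intro m
  have hx : ∑ k, (x : EuclideanSpace ℝ (Fin (n + 1))) k = 0 := x.2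
  simp [eSub_apply, mul_sub, Finset.sum_sub_distrib, hx]

/-- The sum-zero vector with prescribed coordinates. -/
def ofCoord (f : Fin (n + 1) → ℝ) (hf : ∑ i, f i = 0) : sumZero n :=
  ⟨WithLp.toLp 2 f, hf⟩

theorem ofCoord_apply (f : Fin (n + 1) → ℝ) (hf : ∑ i, f i = 0) (i : Fin (n + 1)) :
    (ofCoord f hf).1 i = f i := rfl

theorem add_eSub_apply (x : sumZero n) (i j k : Fin (n + 1)) :
    (x + eSub i j).1 k = x.1 k + ((if k = i then 1 else 0) - (if k = j then 1 else 0)) := by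
  rw [← eSub_apply]; rfl

theorem sub_apply (x y : sumZero n) (k : Fin (n + 1)) : (x - y).1 k = x.1 k - y.1 k := rfl

theorem add_apply (x y : sumZero n) (k : Fin (n + 1)) : (x + y).1 k = x.1 k + y.1 k := rfl

theorem smul_apply (c : ℝ) (x : sumZero n) (k : Fin (n + 1)) : (c • x).1 k = c * x.1 k := rfl

theorem eSub_mem_roots {i j : Fin (n + 1)} (hij : i ≠ j) : eSub i j ∈ (typeA n).roots :=
  ⟨i, j, hij, rfl⟩

theorem eSub_mem_posRoots {i j : Fin (n + 1)} (hij : i < j) : eSub i j ∈ (typeA n).posRoots := by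
  refine ⟨eSub_mem_roots hij.ne, ?_⟩
  obtain ⟨c, hc⟩ := eSub_pos i j hij.le
  refine ⟨c, hc.trans ?_⟩
  simp only [typeA, simpleBasis_apply]

theorem mem_rootLattice_iff (x : sumZero n) :
    x ∈ (typeA n).rootLattice ↔ ∀ i, ∃ m : ℤ, x.1 i = m := by
  constructor
  · intro hx
    induction hx using AddSubgroup.closure_induction with
    | mem x hx =>
      obtain ⟨i, j, -, rfl⟩ := hx
      intro k
      refine ⟨(if k = i then 1 else 0) - (if k = j then 1 else 0), ?_⟩
      rw [eSub_apply]; push_cast; rfl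
    | zero => exact fun i => ⟨0, by simp⟩
    | add x y _ _ hx hy =>
      intro i
      obtain ⟨a, ha⟩ := hx i
      obtain ⟨b, hb⟩ := hy i
      exact ⟨a + b, by rw [add_apply, ha, hb]; push_cast; rfl⟩
    | neg x _ hx =>
      intro i
      obtain ⟨a, ha⟩ := hx i
      exact ⟨-a, by push_cast; rw [← ha]; rfl⟩
  · intro h
    choose m hm using h
    rw [eq_sum_smul_eSub x]
    refine AddSubgroup.sum_mem _ fun k _ => ?_
    rw [hm k, Int.cast_smul_eq_zsmul]
    refine AddSubgroup.zsmul_mem _ ?_ _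
    by_cases hk : k = 0
    · rw [hk, eSub_self]; exact AddSubgroup.zero_mem _
    · exact AddSubgroup.subset_closure (eSub_mem_roots hk)

theorem mem_weightLattice_iff (x : sumZero n) :
    x ∈ (typeA n).weightLattice ↔ ∀ i j, ∃ m : ℤ, x.1 i - x.1 j = m := by
  constructor
  · intro h i j
    by_cases hij : i = j
    · exact ⟨0, by simp [hij]⟩
    · obtain ⟨m, hm⟩ := h _ (eSub_mem_roots hij)
      exact ⟨m, by rw [← hm, inner_dualVector_eSub x hij]⟩
  · rintro h _ ⟨i, j, hij, rfl⟩
    rw [inner_dualVector_eSub x hij]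
    exact h i j

theorem exists_perm_of_mem_weylGroup {w : sumZero n ≃ₗᵢ[ℝ] sumZero n}
    (hw : w ∈ (typeA n).weylGroup) :
    ∃ σ : Equiv.Perm (Fin (n + 1)), ∀ x i, (w x).1 i = x.1 (σ i) := by
  induction hw using Subgroup.closure_induction with
  | mem w hw =>
    obtain ⟨_, ⟨i, j, hij, rfl⟩, rfl⟩ := hw
    exact ⟨Equiv.swap i j, fun x k => rootReflection_eSub_apply x hij k⟩
  | one => exact ⟨1, fun _ _ => rfl⟩
  | mul w₁ w₂ _ _ h₁ h₂ =>
    obtain ⟨σ, hσ⟩ := h₁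
    obtain ⟨τ, hτ⟩ := h₂
    -- The order is reversed because permutations act by precomposition on indices.
    exact ⟨τ * σ, fun x i => by
      change (w₁ (w₂ x)).1 i = _
      rw [hσ, hτ]; rfl⟩
  | inv w _ h =>
    obtain ⟨σ, hσ⟩ := h
    refine ⟨σ⁻¹, fun x i => ?_⟩
    have h1 : w (w⁻¹ x) = x := w.apply_symm_apply x
    have h2 := hσ (w⁻¹ x) (σ⁻¹ i)
    rw [h1] at h2
    rw [h2]; simp

theorem exists_mem_weylGroup_of_perm (σ : Equiv.Perm (Fin (n + 1))) :
    ∃ w ∈ (typeA n).weylGroup, ∀ x i, (w x).1 i = x.1 (σ i) := by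
  induction σ using Equiv.Perm.swap_induction_on with
  | one => exact ⟨1, Subgroup.one_mem _, fun _ _ => rfl⟩
  | swap_mul τ a b hab ih =>
    obtain ⟨w, hw, h⟩ := ih
    refine ⟨w * rootReflection (eSub a b), Subgroup.mul_mem _ hw
      (Subgroup.subset_closure ⟨_, eSub_mem_roots hab, rfl⟩), fun x i => ?_⟩
    change (w (rootReflection (eSub a b) x)).1 i = _
    rw [h, rootReflection_eSub_apply x hab]; rfl

theorem mem_weylOrbit_iff (u x : sumZero n) :
    u ∈ (typeA n).weylOrbit x ↔ ∃ σ : Equiv.Perm (Fin (n + 1)), ∀ i, u.1 i = x.1 (σ i) := by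
  constructor
  · rintro ⟨w, hw, rfl⟩
    obtain ⟨σ, hσ⟩ := exists_perm_of_mem_weylGroup hw
    exact ⟨σ, hσ x⟩
  · rintro ⟨σ, hσ⟩
    obtain ⟨w, hw, h⟩ := exists_mem_weylGroup_of_perm σ
    exact ⟨w, hw, ext_coord fun i => by rw [hσ, h]⟩

theorem weylOrbit_finite (x : sumZero n) : ((typeA n).weylOrbit x).Finite := by
  refine (Set.finite_range fun σ : Equiv.Perm (Fin (n + 1)) =>
    ofCoord (fun i => x.1 (σ i)) ((Equiv.sum_comp σ _).trans (sum_coord x))).subset ?_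
  intro u hu
  obtain ⟨σ, hσ⟩ := (mem_weylOrbit_iff u x).1 hu
  exact ⟨σ, ext_coord fun i => (hσ i).symm⟩

/-- Pairing with the simple coroots makes consecutive coordinates drop by one; the zero sum then
fixes the first. -/
theorem weylVector_apply (i : Fin (n + 1)) :
    ((typeA n).weylVector).1 i = (n : ℝ) / 2 - i := by
  have hstep : ∀ k : Fin n, ((typeA n).weylVector).1 k.castSucc
      - ((typeA n).weylVector).1 k.succ = 1 := by
    intro k
    rw [← inner_dualVector_eSub _ Fin.castSucc_lt_succ.ne, ← simpleBasis_apply,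
      BasedRootSystem.weylVector, sum_inner]
    exact (Finset.sum_congr rfl fun j _ => (typeA n).inner_fundamentalWeight j k).trans (by simp)
  have hz : ∀ j : Fin (n + 1),
      ((typeA n).weylVector).1 j = ((typeA n).weylVector).1 0 - j := by
    intro j
    induction j using Fin.induction with
    | zero => simp
    | succ k ih =>
      have := hstep k
      rw [ih] at this
      simp only [Fin.val_castSucc, Fin.val_succ] at this ⊢
      push_cast
      linarith
  have hs := sum_coord (typeA n).weylVector
  rw [Finset.sum_congr rfl fun j _ => hz j, Finset.sum_sub_distrib,
    Fin.sum_univ_eq_sum_range (fun j => (j : ℝ)), ← Nat.cast_sum] at hs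
  have hg : (((∑ j ∈ Finset.range (n + 1), j : ℕ) : ℝ)) * 2 = (n + 1) * n := by
    exact_mod_cast Finset.sum_range_id_mul_two (n + 1)
  simp only [Finset.sum_const, Finset.card_univ, Fintype.card_fin, nsmul_eq_mul] at hs
  push_cast at hs hg
  have h0 : ((typeA n).weylVector).1 0 = (n : ℝ) / 2 := by
    have : ((n : ℝ) + 1) * (((typeA n).weylVector).1 0 - n / 2) = 0 := by linarith
    rcases mul_eq_zero.1 this with h | h
    · exact absurd h (by positivity)
    · linarith
  rw [hz, h0]

end TypeA

/-! ### Extremal sums of distinct integers, and firing on integer vectors. -/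

section Combinatorics

/-- Peel off the maximum of `T`: it is at least the number of remaining elements, so its value is at
most the next term of the initial segment. -/
theorem Finset.sum_le_sum_range_card_of_antitone {M : Type*} [AddCommMonoid M] [PartialOrder M]
    [IsOrderedAddMonoid M] {f : ℕ → M} (hf : Antitone f) (T : Finset ℕ) :
    ∑ i ∈ T, f i ≤ ∑ i ∈ Finset.range T.card, f i := by
  induction T using Finset.induction_on_max with
  | empty => simp
  | insert a T ha ih =>
    have hna : a ∉ T := fun h => lt_irrefl _ (ha a h)
    rw [Finset.sum_insert hna, Finset.card_insert_of_notMem hna, Finset.sum_range_succ, add_comm]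
    refine add_le_add ih (hf ?_)
    calc T.card ≤ (Finset.range a).card :=
          Finset.card_le_card fun x hx => Finset.mem_range.2 (ha x hx)
      _ = a := Finset.card_range a

theorem Finset.card_mul_add_sum_range_le {ι : Type*} {z : ι → ℤ} {S : Finset ι}
    (hz : Set.InjOn z S) {a : ℤ} (ha : ∀ x ∈ S, a ≤ z x) :
    (S.card : ℤ) * a + ∑ i ∈ Finset.range S.card, (i : ℤ) ≤ ∑ x ∈ S, z x := by
  classical
  have hinj : Set.InjOn (fun x => (z x - a).toNat) S := by
    intro x hx y hy hxy
    have h1 := ha x hx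
    have h2 := ha y hy
    simp only at hxy
    exact hz hx hy (by omega)
  have h := Finset.sum_le_sum_range_card_of_antitone (f := fun i => -(i : ℤ))
    (fun i j hij => by simpa using hij) (S.image fun x => (z x - a).toNat)
  rw [Finset.card_image_of_injOn hinj, Finset.sum_image hinj] at h
  have h3 : ∑ x ∈ S, -(((z x - a).toNat : ℕ) : ℤ) = ∑ x ∈ S, (a - z x) :=
    Finset.sum_congr rfl fun x hx => by have := ha x hx; omega
  rw [h3, Finset.sum_sub_distrib, Finset.sum_neg_distrib, Finset.sum_const, nsmul_eq_mul] at h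
  linarith

theorem Finset.sum_le_card_mul_sub_sum_range {ι : Type*} {z : ι → ℤ} {S : Finset ι}
    (hz : Set.InjOn z S) {b : ℤ} (hb : ∀ x ∈ S, z x ≤ b) :
    ∑ x ∈ S, z x ≤ (S.card : ℤ) * b - ∑ i ∈ Finset.range S.card, (i : ℤ) := by
  have h := Finset.card_mul_add_sum_range_le (z := fun x => -z x) (S := S)
    (fun x hx y hy hxy => hz hx hy (neg_injective hxy)) (a := -b)
    (fun x hx => neg_le_neg (hb x hx))
  rw [Finset.sum_neg_distrib] at h
  linarith

/-- The integers `0, -1, -2, …`, with the first `m` of them raised by one. -/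
def raisedStair (m i : ℕ) : ℤ := -(i : ℤ) + if i < m then 1 else 0

theorem raisedStair_succ_lt (m i : ℕ) : raisedStair m (i + 1) + 1 ≤ raisedStair m i := by
  unfold raisedStair
  split_ifs <;> push_cast <;> omega

theorem raisedStair_antitone (m : ℕ) : Antitone (raisedStair m) :=
  antitone_nat_of_succ_le fun i => by have := raisedStair_succ_lt m i; omega

theorem sum_raisedStair (m k : ℕ) :
    2 * ∑ i ∈ Finset.range k, raisedStair m i = -((k : ℤ) * (k - 1)) + 2 * min k m := by
  induction k with
  | zero => simp
  | succ k ih =>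
    rw [Finset.sum_range_succ, mul_add, ih, raisedStair]
    have h : ((min (k + 1) m : ℕ) : ℤ) = (min k m : ℕ) + if k < m then 1 else 0 := by
      split_ifs <;> omega
    rw [h]
    push_cast
    ring

theorem two_mul_sum_range_cast (k : ℕ) :
    2 * ∑ i ∈ Finset.range k, (i : ℤ) = (k : ℤ) * (k - 1) := by
  induction k with
  | zero => simp
  | succ k ih => rw [Finset.sum_range_succ, mul_add, ih]; push_cast; ring

/-- Distinctness bounds the sum over `A` below through `a`, and the sum over the complement above
through `b`. With the total prescribed and `b < a`, one of the two bounds always suffices. -/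
theorem sum_raisedStair_le_of_injective {ι : Type*} [Fintype ι] [DecidableEq ι] {z : ι → ℤ}
    (hz : Function.Injective z) {m : ℕ} (hm : m ≤ Fintype.card ι)
    (hsum : ∑ i, z i = ∑ i ∈ Finset.range (Fintype.card ι), raisedStair m i)
    {A : Finset ι} {a b : ℤ} (hab : b < a) (hA : ∀ x ∈ A, a ≤ z x) (hB : ∀ x ∉ A, z x ≤ b) :
    ∑ i ∈ Finset.range A.card, raisedStair m i ≤ ∑ x ∈ A, z x := by
  have h1 := Finset.card_mul_add_sum_range_le (S := A) hz.injOn hA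
  have h2 := Finset.sum_le_card_mul_sub_sum_range (S := Aᶜ) hz.injOn
    (fun x hx => hB x (Finset.mem_compl.1 hx))
  have hs := Finset.sum_add_sum_compl A z
  have hc := Finset.card_add_card_compl A
  rw [hsum] at hs
  rw [← hc] at hs hm
  have g1 := two_mul_sum_range_cast A.card
  have g2 := two_mul_sum_range_cast Aᶜ.card
  have r1 := sum_raisedStair m A.card
  have r2 := sum_raisedStair m (A.card + Aᶜ.card)
  generalize ∑ x ∈ A, z x = SA at *
  generalize ∑ x ∈ Aᶜ, z x = SB at *
  generalize ∑ i ∈ Finset.range A.card, (i : ℤ) = gk at *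
  generalize ∑ i ∈ Finset.range Aᶜ.card, (i : ℤ) = gl at *
  generalize ∑ i ∈ Finset.range A.card, raisedStair m i = rk at *
  generalize ∑ i ∈ Finset.range (A.card + Aᶜ.card), raisedStair m i = rN at *
  generalize A.card = k at *
  generalize Aᶜ.card = l at *
  have hmin : min (k + l) m = m := by omega
  rw [hmin] at r2
  push_cast at r2
  by_contra! hlt
  -- If the sum over `A` is too small and `k ≤ m`, the bound on `A` forces `a ≤ 1 - k`, so `b ≤ -k`,
  -- and the complement is then too small to reach the total. If `k > m`, the complement forces `b ≥
  -- 1 - k`, so `a ≥ 2 - k`, and the sum over `A` is not too small.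
  rcases le_or_gt k m with hkm | hkm
  · have e : min k m = k := by omega
    rw [e] at r1
    have ha : a ≤ 1 - k := by
      by_contra! h
      have : (k : ℤ) * (2 - k) ≤ k * a := mul_le_mul_of_nonneg_left (by omega) (by omega)
      nlinarith
    have hb : (l : ℤ) * b ≤ l * (-k) := mul_le_mul_of_nonneg_left (by omega) (by omega)
    have hkm' : (k : ℤ) ≤ m := by exact_mod_cast hkm
    nlinarith
  · have e : min k m = m := by omega
    rw [e] at r1
    have hb : 1 - (k : ℤ) ≤ b := by
      by_contra! h
      have : (l : ℤ) * b ≤ l * (-k) := mul_le_mul_of_nonneg_left (by omega) (by omega)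
      nlinarith
    have ha : (k : ℤ) * (2 - k) ≤ k * a := mul_le_mul_of_nonneg_left (by omega) (by omega)
    have hkm' : (m : ℤ) < k := by exact_mod_cast hkm
    nlinarith

/-- The integer configuration obtained from `z` by moving `i` up and `j` down by one. -/
def fire {ι : Type*} [DecidableEq ι] (z : ι → ℤ) (i j : ι) : ι → ℤ :=
  fun k => z k + ((if k = i then 1 else 0) - (if k = j then 1 else 0))

variable {ι : Type*} [DecidableEq ι]

theorem sum_fire (z : ι → ℤ) (i j : ι) (S : Finset ι) :
    ∑ k ∈ S, fire z i j k =
      ∑ k ∈ S, z k + ((if i ∈ S then 1 else 0) - (if j ∈ S then 1 else 0)) := by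
  simp [fire, Finset.sum_add_distrib, Finset.sum_sub_distrib]

/-- The strictly increasing quantity that makes firing terminate once the entries are bounded. -/
theorem sum_sq_fire [Fintype ι] (z : ι → ℤ) {i j : ι} (hij : i ≠ j) (h : z i = z j) :
    ∑ k, fire z i j k ^ 2 = ∑ k, z k ^ 2 + 2 := by
  have : ∀ k, fire z i j k ^ 2 = z k ^ 2 + (if k = i then 2 * z k + 1 else 0)
      - (if k = j then 2 * z k - 1 else 0) := by
    intro k
    unfold fire
    by_cases h1 : k = i
    · rw [if_pos h1, if_pos h1, if_neg (h1 ▸ hij), if_neg (h1 ▸ hij)]; ring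
    · rw [if_neg h1, if_neg h1]
      split_ifs <;> ring
  simp only [this, Finset.sum_add_distrib, Finset.sum_sub_distrib, Finset.sum_ite_eq',
    Finset.mem_univ, if_true]
  omega

/-! ### Strictly concave bounds and their tight sets. -/

variable [Fintype ι] {z : ι → ℤ} {G : ℕ → ℤ}

/-- Since `z i = z j`, the sums over `S \ {i}` and `S ∪ {j}` add up to twice the sum over `S`; the
bounds for these two sets and strict concavity leave room of at least one half, hence strictness. -/
theorem sum_lt_of_eq_of_mem_of_notMem
    (hG : ∀ k, k + 2 ≤ Fintype.card ι → G k + G (k + 2) + 1 ≤ 2 * G (k + 1))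
    (hz : ∀ S : Finset ι, ∑ k ∈ S, z k ≤ G S.card)
    {i j : ι} (h : z i = z j) {S : Finset ι}
    (hi : i ∈ S) (hj : j ∉ S) : ∑ k ∈ S, z k < G S.card := by
  have h1 := hz (S.erase i)
  have h2 := hz (insert j S)
  have hc : (S.erase i).card + 1 = S.card := Finset.card_erase_add_one hi
  have hc' := Finset.card_insert_of_notMem hj
  have hN := Finset.card_le_univ (insert j S)
  have h3 := Finset.add_sum_erase S z hi
  rw [Finset.sum_insert hj] at h2
  have h4 := hG (S.erase i).card (by omega)
  rw [hc'] at h2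
  rw [← hc] at h2 ⊢
  linarith

/-- A sum grows, by one, only if `S` contains `i` but not `j`, and then there was slack. -/
theorem sum_fire_le
    (hG : ∀ k, k + 2 ≤ Fintype.card ι → G k + G (k + 2) + 1 ≤ 2 * G (k + 1))
    (hz : ∀ S : Finset ι, ∑ k ∈ S, z k ≤ G S.card)
    {i j : ι} (h : z i = z j) (S : Finset ι) :
    ∑ k ∈ S, fire z i j k ≤ G S.card := by
  rw [sum_fire]
  have h1 := hz S
  by_cases hi : i ∈ S
  · by_cases hj : j ∈ S
    · simpa [hi, hj] using h1
    · have := sum_lt_of_eq_of_mem_of_notMem hG hz h hi hj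
      simp only [hi, hj, if_true, if_false]
      omega
  · simp only [hi, if_false]
    split_ifs <;> omega

theorem mem_iff_mem_of_sum_eq
    (hG : ∀ k, k + 2 ≤ Fintype.card ι → G k + G (k + 2) + 1 ≤ 2 * G (k + 1))
    (hz : ∀ S : Finset ι, ∑ k ∈ S, z k ≤ G S.card)
    {i j : ι} (h : z i = z j) {S : Finset ι}
    (hS : ∑ k ∈ S, z k = G S.card) : i ∈ S ↔ j ∈ S := by
  by_contra hn
  rcases (not_iff.1 hn) with hn
  by_cases hi : i ∈ S
  · exact (sum_lt_of_eq_of_mem_of_notMem hG hz h hi (fun hj => hn.2 hj hi)).ne hS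
  · exact (sum_lt_of_eq_of_mem_of_notMem hG hz h.symm (hn.1 hi) hi).ne hS

end Combinatorics

/-! ### Majorization description of the permutohedron and its interior. -/

namespace TypeA
variable {n : ℕ}

/-- The sum of the coordinates in `S`, as a linear functional. -/
noncomputable def coordSum (S : Finset (Fin (n + 1))) : sumZero n →ₗ[ℝ] ℝ where
  toFun x := ∑ k ∈ S, x.1 k
  map_add' x y := by simp only [add_apply, Finset.sum_add_distrib]
  map_smul' c x := by simp only [smul_apply, Finset.mul_sum, RingHom.id_apply, smul_eq_mul]

theorem coordSum_apply (S : Finset (Fin (n + 1))) (x : sumZero n) :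
    coordSum S x = ∑ k ∈ S, x.1 k := rfl

theorem coordSum_eSub (S : Finset (Fin (n + 1))) (i j : Fin (n + 1)) :
    coordSum S (eSub i j) = (if i ∈ S then 1 else 0) - (if j ∈ S then 1 else 0) := by
  simp [coordSum_apply, eSub_apply, Finset.sum_sub_distrib]

theorem continuous_coordSum (S : Finset (Fin (n + 1))) :
    Continuous (coordSum S) := (coordSum S).continuous_of_finiteDimensional

variable {f : ℕ → ℝ} {w x : sumZero n}

theorem coordSum_le_of_mem_permutohedron (hf : Antitone f) (hw : ∀ i, w.1 i = f i)
    (hx : x ∈ (typeA n).permutohedron w) (S : Finset (Fin (n + 1))) :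
    coordSum S x ≤ ∑ i ∈ Finset.range S.card, f i := by
  refine convexHull_min (t := {x | coordSum S x ≤ ∑ i ∈ Finset.range S.card, f i}) ?_
    (convex_halfSpace_le (coordSum S).isLinear _) hx
  intro u hu
  obtain ⟨σ, hσ⟩ := (mem_weylOrbit_iff u w).1 hu
  have hinj : Set.InjOn (fun i => ((σ i : Fin (n + 1)) : ℕ)) S :=
    (Fin.val_injective.comp σ.injective).injOn
  have h := Finset.sum_le_sum_range_card_of_antitone hf (S.image fun i => ((σ i : Fin (n + 1)) : ℕ))
  rw [Finset.sum_image hinj, Finset.card_image_of_injOn hinj] at h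
  change coordSum S u ≤ _
  rw [coordSum_apply, Finset.sum_congr rfl fun i _ => (hσ i).trans (hw _)]
  exact h

theorem mul_sum_range_le_of_antitone {C D : ℕ → ℝ} {N : ℕ}
    (hC : ∀ k < N, C (k + 1) ≤ C k)
    (hD : ∀ k ≤ N, 0 ≤ ∑ i ∈ Finset.range k, D i) :
    C N * ∑ i ∈ Finset.range (N + 1), D i ≤ ∑ i ∈ Finset.range (N + 1), C i * D i := by
  induction N with
  | zero => simp
  | succ k ih =>
    have h := ih (fun j hj => hC j (by omega)) (fun j hj => hD j (by omega))
    rw [Finset.sum_range_succ, Finset.sum_range_succ _ (k + 1), mul_add]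
    have h1 := mul_le_mul_of_nonneg_right (hC k (by omega)) (hD (k + 1) le_rfl)
    linarith

/-- Abel summation: the differences `f - X` have nonnegative partial sums and total zero, so
weighting them by a decreasing `C` gives a nonnegative result. -/
theorem sum_mul_le_sum_mul_of_antitone {C X : Fin (n + 1) → ℝ} (hC : Antitone C)
    (hX : ∀ S : Finset (Fin (n + 1)), ∑ i ∈ S, X i ≤ ∑ i ∈ Finset.range S.card, f i)
    (hsum : ∑ i, X i = ∑ i ∈ Finset.range (n + 1), f i) :
    ∑ i, C i * X i ≤ ∑ i : Fin (n + 1), C i * f i := by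
  -- Extending to `ℕ` allows sums over `Finset.range`; the default value is never used.
  let C' : ℕ → ℝ := fun k => if h : k < n + 1 then C ⟨k, h⟩ else 0
  let X' : ℕ → ℝ := fun k => if h : k < n + 1 then X ⟨k, h⟩ else 0
  have hC' : ∀ i : Fin (n + 1), C i = C' i := fun i => by
    simp only [C', dif_pos i.2]
  have hX' : ∀ i : Fin (n + 1), X i = X' i := fun i => by
    simp only [X', dif_pos i.2]
  have key := mul_sum_range_le_of_antitone (N := n) (C := C') (D := fun k => f k - X' k)
    (fun k hk => by
      simp only [C', dif_pos (show k < n + 1 by omega), dif_pos (show k + 1 < n + 1 by omega)]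
      exact hC (by simp [Fin.le_def]))
    (fun k hk => by
      have h := hX (Finset.univ.filter fun i : Fin (n + 1) => (i : ℕ) < k)
      have himg : (Finset.univ.filter fun i : Fin (n + 1) => (i : ℕ) < k).image Fin.val
          = Finset.range k := by
        ext a
        simp only [Finset.mem_image, Finset.mem_filter, Finset.mem_univ, true_and,
          Finset.mem_range]
        constructor
        · rintro ⟨i, hi, rfl⟩; exact hi
        · intro ha; exact ⟨⟨a, by omega⟩, ha, rfl⟩
      have hcard : (Finset.univ.filter fun i : Fin (n + 1) => (i : ℕ) < k).card = k := by
        rw [← Finset.card_image_of_injective _ Fin.val_injective, himg, Finset.card_range]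
      rw [hcard, Finset.sum_congr rfl fun i _ => hX' i,
        ← Finset.sum_image (f := X') Fin.val_injective.injOn, himg] at h
      rw [Finset.sum_sub_distrib]
      linarith)
  have hz : ∑ i ∈ Finset.range (n + 1), (f i - X' i) = 0 := by
    rw [Finset.sum_sub_distrib, ← hsum, Finset.sum_congr rfl fun i _ => hX' i,
      Fin.sum_univ_eq_sum_range X', sub_self]
  rw [hz, mul_zero] at key
  have e1 : ∑ i, C i * X i = ∑ i ∈ Finset.range (n + 1), C' i * X' i := by
    rw [← Fin.sum_univ_eq_sum_range (fun i => C' i * X' i)]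
    exact Finset.sum_congr rfl fun i _ => by rw [hC', hX']
  have e2 : ∑ i : Fin (n + 1), C i * f i = ∑ i ∈ Finset.range (n + 1), C' i * f i := by
    rw [← Fin.sum_univ_eq_sum_range (fun i => C' i * f i)]
    exact Finset.sum_congr rfl fun i _ => by rw [hC']
  simp only [mul_sub, Finset.sum_sub_distrib] at key
  rw [e1, e2]
  linarith

/-- Rado's theorem: a sum-zero vector majorized by `w` lies in the permutohedron of `w`. -/
theorem mem_permutohedron_of_forall_coordSum_le (hw : ∀ i, w.1 i = f i)
    (hx : ∀ S : Finset (Fin (n + 1)), coordSum S x ≤ ∑ i ∈ Finset.range S.card, f i) :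
    x ∈ (typeA n).permutohedron w := by
  by_contra hnot
  obtain ⟨φ, u, hlt, hgt⟩ := geometric_hahn_banach_closed_point
    (convex_convexHull ℝ ((typeA n).weylOrbit w))
    ((weylOrbit_finite w).isClosed_convexHull ℝ) hnot
  let c : Fin (n + 1) → ℝ := fun k => φ (eSub k 0)
  have hφ : ∀ y : sumZero n, φ y = ∑ k, y.1 k * c k := by
    intro y
    conv_lhs => rw [eq_sum_smul_eSub y]
    simp [c]
  let σ : Equiv.Perm (Fin (n + 1)) := Tuple.sort fun k => -c k
  have hσ : Antitone fun k => c (σ k) := fun a b hab =>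
    neg_le_neg_iff.1 (Tuple.monotone_sort (fun k => -c k) hab)
  -- The orbit point matching the coordinates of `w`, in order, with the coefficients of `φ` sorted
  -- decreasingly. Abel summation gives `φ x ≤ φ y`, contradicting separation.
  let y : sumZero n := ofCoord (fun i => w.1 (σ⁻¹ i))
    ((Equiv.sum_comp σ⁻¹ _).trans (sum_coord w))
  have hy : y ∈ (typeA n).weylOrbit w := (mem_weylOrbit_iff _ _).2 ⟨σ⁻¹, fun i => rfl⟩
  have h1 := hlt y (subset_convexHull ℝ _ hy)
  have hle := sum_mul_le_sum_mul_of_antitone (f := f) (X := fun k => x.1 (σ k)) hσ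
    (fun S => by
      have := hx (S.map σ.toEmbedding)
      rw [coordSum_apply, Finset.sum_map, Finset.card_map] at this
      exact this)
    (by
      rw [Equiv.sum_comp σ (fun k => x.1 k), sum_coord,
        ← Fin.sum_univ_eq_sum_range f, ← Finset.sum_congr rfl fun i _ => hw i, sum_coord])
  have e1 : φ x = ∑ i, c (σ i) * x.1 (σ i) := by
    rw [hφ, ← Equiv.sum_comp σ]
    exact Finset.sum_congr rfl fun i _ => mul_comm _ _
  have e2 : φ y = ∑ i, c (σ i) * f i := by
    rw [hφ, ← Equiv.sum_comp σ]
    refine Finset.sum_congr rfl fun i _ => ?_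
    rw [mul_comm, ← hw]
    simp [y, ofCoord_apply]
  linarith

theorem mem_interior_permutohedron_iff (hf : Antitone f) (hw : ∀ i, w.1 i = f i) :
    x ∈ interior ((typeA n).permutohedron w) ↔
      ∀ S : Finset (Fin (n + 1)), S.Nonempty → S ≠ Finset.univ →
        coordSum S x < ∑ i ∈ Finset.range S.card, f i := by
  constructor
  · intro hx S hS hS'
    obtain ⟨i, hi⟩ := hS
    obtain ⟨j, hj⟩ : ∃ j, j ∉ S := by
      by_contra! h
      exact hS' (Finset.eq_univ_iff_forall.2 h)
    -- A small push along `e_i - e_j` stays in the polytope and raises the sum over `S`, so that sum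
    -- was not maximal.
    have hc : Filter.Tendsto (fun ε : ℝ => x + ε • eSub i j) (nhds 0) (nhds x) := by
      refine Continuous.tendsto' (by fun_prop) _ _ (by simp)
    have hev := (hc.eventually (mem_interior_iff_mem_nhds.1 hx)).filter_mono
      (nhdsWithin_le_nhds (s := Set.Ioi 0))
    obtain ⟨ε, hε, hpos⟩ := (hev.and self_mem_nhdsWithin).exists
    have h := coordSum_le_of_mem_permutohedron hf hw hε S
    rw [map_add, map_smul, coordSum_eSub, if_pos hi, if_neg hj] at h
    have : (0 : ℝ) < ε := hpos
    simp only [sub_zero, smul_eq_mul, mul_one] at h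
    linarith
  · intro h
    let U : Set (sumZero n) := {y | ∀ S ∈ (Finset.univ.filter
      fun S : Finset (Fin (n + 1)) => S.Nonempty ∧ S ≠ Finset.univ),
        coordSum S y < ∑ i ∈ Finset.range S.card, f i}
    have hU : IsOpen U := by
      have : U = ⋂ S ∈ (Finset.univ.filter
          fun S : Finset (Fin (n + 1)) => S.Nonempty ∧ S ≠ Finset.univ),
          {y | coordSum S y < ∑ i ∈ Finset.range S.card, f i} := by
        ext y; simp [U]
      rw [this]
      exact isOpen_biInter_finset fun S _ => isOpen_lt (continuous_coordSum S) continuous_const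
    refine interior_maximal (s := (typeA n).permutohedron w) ?_ hU ?_
    · intro y hy
      refine mem_permutohedron_of_forall_coordSum_le hw fun S => ?_
      rcases S.eq_empty_or_nonempty with rfl | hS
      · simp [coordSum_apply]
      by_cases hS' : S = Finset.univ
      · subst hS'
        rw [coordSum_apply, sum_coord, Finset.card_univ, Fintype.card_fin,
          ← Fin.sum_univ_eq_sum_range f, ← Finset.sum_congr rfl fun i _ => hw i, sum_coord]
      · exact (hy S (by simp [hS, hS'])).le
    · intro S hS
      simp only [Finset.mem_filter, Finset.mem_univ, true_and] at hS
      exact h S hS.1 hS.2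

end TypeA

/-! ### Central firing and connectedness. -/

namespace TypeA
variable {n : ℕ}

theorem exists_of_centralFires {u u' : sumZero n} (h : (typeA n).CentralFires u u') :
    ∃ i j, i ≠ j ∧ u.1 i = u.1 j ∧ u' = u + eSub i j := by
  obtain ⟨_, ⟨⟨i, j, hij, rfl⟩, -⟩, h0, rfl⟩ := h
  rw [inner_dualVector_eSub u hij] at h0
  exact ⟨i, j, hij, sub_eq_zero.1 h0, rfl⟩

theorem centralFires_add_eSub {u : sumZero n} {i j : Fin (n + 1)} (hij : i < j)
    (h : u.1 i = u.1 j) : (typeA n).CentralFires u (u + eSub i j) :=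
  ⟨_, eSub_mem_posRoots hij, by rw [inner_dualVector_eSub u hij.ne, h, sub_self], rfl⟩

theorem add_eSub_apply_eq_fire {u : sumZero n} {t : ℝ} {z : Fin (n + 1) → ℤ}
    (hu : ∀ i, u.1 i = t + z i) (i j k : Fin (n + 1)) :
    (u + eSub i j).1 k = t + fire z i j k := by
  rw [add_eSub_apply, hu, fire]
  push_cast
  ring

theorem coordSum_eq {u : sumZero n} {t : ℝ} {z : Fin (n + 1) → ℤ}
    (hu : ∀ i, u.1 i = t + z i) (S : Finset (Fin (n + 1))) :
    coordSum S u = S.card * t + (∑ k ∈ S, z k : ℤ) := by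
  rw [coordSum_apply, Finset.sum_congr rfl fun i _ => hu i]
  simp [Finset.sum_add_distrib]

variable {v : sumZero n} {t : ℝ} {z : Fin (n + 1) → ℤ}

/-- Every weight reached by central firing satisfies the strictly concave bounds which hold at the
start. -/
theorem sum_le_of_reachable (hv : ∀ i, v.1 i = t + z i) {G : ℕ → ℤ}
    (hG : ∀ k, k + 2 ≤ n + 1 → G k + G (k + 2) + 1 ≤ 2 * G (k + 1))
    (hz : ∀ S : Finset (Fin (n + 1)), ∑ k ∈ S, z k ≤ G S.card) {u : sumZero n}
    (h : Relation.ReflTransGen (typeA n).CentralFires v u) :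
    ∃ y : Fin (n + 1) → ℤ, (∀ i, u.1 i = t + y i) ∧ (∀ S, ∑ k ∈ S, y k ≤ G S.card) ∧
      ∀ S : Finset (Fin (n + 1)), ∑ k ∈ S, z k = G S.card → ∑ k ∈ S, y k = G S.card := by
  induction h with
  | refl => exact ⟨z, hv, hz, fun _ h => h⟩
  | tail _ hstep ih =>
    obtain ⟨y, hy, hle, heq⟩ := ih
    obtain ⟨i, j, hij, hp, rfl⟩ := exists_of_centralFires hstep
    rw [hy, hy, add_right_inj, Int.cast_inj] at hp
    have hG' : ∀ k, k + 2 ≤ Fintype.card (Fin (n + 1)) →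
        G k + G (k + 2) + 1 ≤ 2 * G (k + 1) := by simpa using hG
    refine ⟨fire y i j, add_eSub_apply_eq_fire hy i j, sum_fire_le hG' hle hp, fun S hS => ?_⟩
    rw [sum_fire, ← heq S hS]
    simp [mem_iff_mem_of_sum_eq hG' hle hp (heq S hS)]

/-- Tightness at `S` survives firing, so the firing span lies in the kernel of `coordSum S`, which
is proper because it misses `e_i - e_j` for `i ∈ S`, `j ∉ S`. -/
theorem not_isConnectedWeight_of_sum_eq (hv : ∀ i, v.1 i = t + z i) {G : ℕ → ℤ}
    (hG : ∀ k, k + 2 ≤ n + 1 → G k + G (k + 2) + 1 ≤ 2 * G (k + 1))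
    (hz : ∀ S : Finset (Fin (n + 1)), ∑ k ∈ S, z k ≤ G S.card)
    {S : Finset (Fin (n + 1))} (hS : S.Nonempty) (hS' : S ≠ Finset.univ)
    (heq : ∑ k ∈ S, z k = G S.card) : ¬ (typeA n).IsConnectedWeight v := by
  intro hconn
  obtain ⟨i, hi⟩ := hS
  obtain ⟨j, hj⟩ : ∃ j, j ∉ S := by
    by_contra! h
    exact hS' (Finset.eq_univ_iff_forall.2 h)
  have hle : (typeA n).firingSpan v ≤ LinearMap.ker (coordSum S) := by
    refine Submodule.span_le.2 ?_
    rintro _ ⟨u, hu, rfl⟩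
    obtain ⟨y, hy, -, hyS⟩ := sum_le_of_reachable hv hG hz hu
    change coordSum S (v - u) = 0
    rw [map_sub, coordSum_eq hv, coordSum_eq hy, hyS S heq, heq, sub_self]
  rw [hconn] at hle
  have h : coordSum S (eSub i j) = 0 := hle (Submodule.mem_top (x := eSub i j))
  rw [coordSum_eSub, if_pos hi, if_neg hj] at h
  norm_num at h

theorem sum_lt_of_isConnectedWeight (hv : ∀ i, v.1 i = t + z i) {R : ℕ → ℤ} (hR0 : R 0 = 0)
    (hR : ∀ k, R k + R (k + 2) + 1 ≤ 2 * R (k + 1)) (hsum : ∑ i, z i = R (n + 1))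
    (hconn : (typeA n).IsConnectedWeight v)
    {S : Finset (Fin (n + 1))} (hS : S.Nonempty) (hS' : S ≠ Finset.univ) :
    ∑ k ∈ S, z k < R S.card := by
  by_contra! hle
  obtain ⟨T, hT, hmax⟩ := Finset.exists_max_image
    (Finset.univ.filter fun T : Finset (Fin (n + 1)) => T.Nonempty ∧ T ≠ Finset.univ)
    (fun T => ∑ k ∈ T, z k - R T.card) ⟨S, by simp [hS, hS']⟩
  simp only [Finset.mem_filter, Finset.mem_univ, true_and] at hT hmax
  have hd := hmax S ⟨hS, hS'⟩
  set d : ℤ := ∑ k ∈ T, z k - R T.card with hdef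
  have hd0 : 0 ≤ d := by linarith
  have hcard : ∀ A : Finset (Fin (n + 1)), A.Nonempty → A ≠ Finset.univ →
      A.card ≠ 0 ∧ A.card ≠ n + 1 := by
    intro A hA hA'
    refine ⟨hA.card_pos.ne', fun h => hA' ?_⟩
    exact Finset.card_eq_iff_eq_univ A |>.1 (by simpa using h)
  -- The ends stay fixed, as the empty and full sums are exact. Concavity survives because the
  -- middle index is always raised by the full `d ≥ 0` and its neighbours by at most `d`.
  let G : ℕ → ℤ := fun k => R k + if k = 0 ∨ k = n + 1 then 0 else d
  have hGin : ∀ A : Finset (Fin (n + 1)), A.Nonempty → A ≠ Finset.univ →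
      G A.card = R A.card + d := by
    intro A hA hA'
    obtain ⟨h1, h2⟩ := hcard A hA hA'
    simp only [G]
    rw [if_neg (by tauto)]
  refine not_isConnectedWeight_of_sum_eq (G := G) hv ?_ ?_ hT.1 hT.2 ?_ hconn
  · intro k hk
    have := hR k
    simp only [G]
    rw [if_neg (show ¬ (k + 1 = 0 ∨ k + 1 = n + 1) by omega)]
    split_ifs <;> linarith
  · intro A
    rcases A.eq_empty_or_nonempty with rfl | hA
    · simp [G, hR0]
    by_cases hA' : A = Finset.univ
    · subst hA'
      simp [G, hsum]
    · rw [hGin A hA hA']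
      have := hmax A ⟨hA, hA'⟩
      linarith
  · rw [hGin T hT.1 hT.2, hdef]
    ring

/-- If two coordinates agree at a reachable `u`, one more move is legal, and the difference of the
two reachable weights is the root itself. -/
theorem eSub_mem_firingSpan {u : sumZero n}
    (hu : Relation.ReflTransGen (typeA n).CentralFires v u) {i j : Fin (n + 1)}
    (h : u.1 i = u.1 j) : eSub i j ∈ (typeA n).firingSpan v := by
  have key : ∀ i j : Fin (n + 1), i < j → u.1 i = u.1 j →
      eSub i j ∈ (typeA n).firingSpan v := by
    intro i j hij h
    have h1 : v - u ∈ (typeA n).firingSpan v := Submodule.subset_span ⟨u, hu, rfl⟩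
    have h2 : v - (u + eSub i j) ∈ (typeA n).firingSpan v :=
      Submodule.subset_span ⟨_, hu.tail (centralFires_add_eSub hij h), rfl⟩
    have h3 := Submodule.sub_mem _ h1 h2
    rwa [show v - u - (v - (u + eSub i j)) = eSub i j by abel] at h3
  rcases lt_trichotomy i j with hij | rfl | hij
  · exact key i j hij h
  · rw [eSub_self]; exact Submodule.zero_mem _
  · rw [← neg_eSub]; exact Submodule.neg_mem _ (key j i hij h.symm)

/-- A set of labels which lie above all the others, such that the two labels facing each other are
not linked by the firing span, keeps its coordinate sum under central firing. -/
theorem exists_separated_of_reachable (hv : ∀ i, v.1 i = t + z i) {A : Finset (Fin (n + 1))}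
    {a b : Fin (n + 1)} (hab : eSub a b ∉ (typeA n).firingSpan v) (ha : a ∈ A) (hb : b ∉ A)
    (hlt : z b < z a) (hA : ∀ x ∈ A, z a ≤ z x) (hB : ∀ x ∉ A, z x ≤ z b) {u : sumZero n}
    (h : Relation.ReflTransGen (typeA n).CentralFires v u) :
    ∃ y : Fin (n + 1) → ℤ, (∀ i, u.1 i = t + y i) ∧ ∑ k ∈ A, y k = ∑ k ∈ A, z k ∧
      ∃ a b, eSub a b ∉ (typeA n).firingSpan v ∧ a ∈ A ∧ b ∉ A ∧ y b < y a ∧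
        (∀ x ∈ A, y a ≤ y x) ∧ ∀ x ∉ A, y x ≤ y b := by
  induction h with
  | refl => exact ⟨z, hv, rfl, a, b, hab, ha, hb, hlt, hA, hB⟩
  | tail hreach hstep ih =>
    obtain ⟨y, hy, hsum, a, b, hab, ha, hb, hlt, hA, hB⟩ := ih
    have hreach' := hreach.tail hstep
    obtain ⟨i, j, hij, hp, rfl⟩ := exists_of_centralFires hstep
    have hmem : eSub i j ∈ (typeA n).firingSpan v := eSub_mem_firingSpan hreach hp
    rw [hy, hy, add_right_inj, Int.cast_inj] at hp
    have hy' := add_eSub_apply_eq_fire hy i j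
    have hlink : ∀ k l, fire y i j k = fire y i j l → eSub k l ∈ (typeA n).firingSpan v :=
      fun k l hkl => eSub_mem_firingSpan hreach' (by rw [hy', hy', hkl])
    have hlink' : ∀ k l, y k = y l → eSub k l ∈ (typeA n).firingSpan v :=
      fun k l hkl => eSub_mem_firingSpan hreach (by rw [hy, hy, hkl])
    have hiff : i ∈ A ↔ j ∈ A := by
      constructor
      · intro hi
        by_contra hj
        have := hA i hi
        have := hB j hj
        omega
      · intro hj
        by_contra hi
        have := hA j hj
        have := hB i hi
        omega
    refine ⟨fire y i j, hy', by rw [sum_fire, hsum]; simp [hiff], ?_⟩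
    have hfi : fire y i j i = y i + 1 := by simp [fire, hij]
    have hfj : fire y i j j = y j - 1 := by simp [fire, hij.symm]; ring
    have hfk : ∀ k, k ≠ i → k ≠ j → fire y i j k = y k := by
      intro k h1 h2; simp [fire, h1, h2]
    by_cases hi : i ∈ A
    · have hj := hiff.1 hi
      have hout : ∀ x ∉ A, fire y i j x = y x := fun x hx =>
        hfk x (fun h => hx (h ▸ hi)) (fun h => hx (h ▸ hj))
      have hge : ∀ x ∈ A, y a - 1 ≤ fire y i j x ∧ (y a < y j → y a ≤ fire y i j x) := by
        intro x hx
        have h1 := hA x hx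
        by_cases e1 : x = i
        · subst e1; rw [hfi]; omega
        by_cases e2 : x = j
        · subst e2; rw [hfj]; omega
        · rw [hfk x e1 e2]; omega
      -- If `j` drops from the lowest level of `A`, it replaces `a`: it is linked to `a`, hence not
      -- to `b`, and so cannot land on the level of `b`.
      rcases (hA j hj).eq_or_lt with hja | hja
      · have hjb : eSub j b ∉ (typeA n).firingSpan v := fun h => hab <| by
          rw [← eSub_add a j b]
          exact Submodule.add_mem _ (hlink' _ _ hja) h
        refine ⟨j, b, hjb, hj, hb, ?_, fun x hx => ?_, fun x hx => ?_⟩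
        · have : fire y i j j ≠ fire y i j b := fun h => hjb (hlink _ _ h)
          rw [hout b hb, hfj] at *
          omega
        · rw [hfj, ← hja]; exact (hge x hx).1
        · rw [hout b hb, hout x hx]; exact hB x hx
      · have hfa : fire y i j a = y a :=
          hfk a (fun h => by rw [h] at hja; omega) (fun h => by rw [h] at hja; omega)
        refine ⟨a, b, hab, ha, hb, by rwa [hfa, hout b hb], fun x hx => ?_, fun x hx => ?_⟩
        · rw [hfa]; exact (hge x hx).2 hja
        · rw [hout b hb, hout x hx]; exact hB x hx
    · have hj : j ∉ A := fun h => hi (hiff.2 h)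
      have hin : ∀ x ∈ A, fire y i j x = y x := fun x hx =>
        hfk x (fun h => hi (h ▸ hx)) (fun h => hj (h ▸ hx))
      have hle : ∀ x ∉ A, fire y i j x ≤ y b + 1 ∧ (y i < y b → fire y i j x ≤ y b) := by
        intro x hx
        have h1 := hB x hx
        by_cases e1 : x = i
        · subst e1; rw [hfi]; omega
        by_cases e2 : x = j
        · subst e2; rw [hfj]; omega
        · rw [hfk x e1 e2]; omega
      -- The mirror case: `i` rises from the top level outside `A` and replaces `b`.
      rcases (hB i hi).eq_or_lt with hib | hib
      · have hai : eSub a i ∉ (typeA n).firingSpan v := fun h => hab <| by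
          rw [← eSub_add a i b]
          exact Submodule.add_mem _ h (hlink' _ _ hib)
        refine ⟨a, i, hai, ha, hi, ?_, fun x hx => ?_, fun x hx => ?_⟩
        · have : fire y i j a ≠ fire y i j i := fun h => hai (hlink _ _ h)
          rw [hin a ha, hfi] at *
          omega
        · rw [hin a ha, hin x hx]; exact hA x hx
        · rw [hfi, hib]; exact (hle x hx).1
      · have hfb : fire y i j b = y b :=
          hfk b (fun h => by rw [h] at hib; omega) (fun h => by rw [h] at hib; omega)
        refine ⟨a, b, hab, ha, hb, by rwa [hfb, hin a ha], fun x hx => ?_, fun x hx => ?_⟩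
        · rw [hin a ha, hin x hx]; exact hA x hx
        · rw [hfb]; exact (hle x hx).2 hib

/-- Under a strictly concave bound which is attained on all labels, central firing reaches a weight
with distinct coordinates. -/
theorem exists_reachable_injective (hv : ∀ i, v.1 i = t + z i) {G : ℕ → ℤ}
    (hG : ∀ k, k + 2 ≤ n + 1 → G k + G (k + 2) + 1 ≤ 2 * G (k + 1))
    (hz : ∀ S : Finset (Fin (n + 1)), ∑ k ∈ S, z k ≤ G S.card) (hsum : ∑ i, z i = G (n + 1)) :
    ∃ u, Relation.ReflTransGen (typeA n).CentralFires v u ∧ ∃ y : Fin (n + 1) → ℤ,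
      (∀ i, u.1 i = t + y i) ∧ Function.Injective y ∧ ∑ i, y i = G (n + 1) := by
  let P : ℤ → Prop := fun e => ∃ u, Relation.ReflTransGen (typeA n).CentralFires v u ∧
    ∃ y : Fin (n + 1) → ℤ, (∀ i, u.1 i = t + y i) ∧ ∑ i, y i ^ 2 = e
  have hyz : ∀ {u : sumZero n}, Relation.ReflTransGen (typeA n).CentralFires v u →
      ∀ y : Fin (n + 1) → ℤ, (∀ i, u.1 i = t + y i) →
        (∀ S, ∑ k ∈ S, y k ≤ G S.card) ∧ ∑ i, y i = G (n + 1) := by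
    intro u hu y hy
    obtain ⟨y', hy', h1, h2⟩ := sum_le_of_reachable hv hG hz hu
    have e : y = y' := funext fun i => by
      have := (hy i).symm.trans (hy' i)
      rwa [add_right_inj, Int.cast_inj] at this
    subst e
    exact ⟨h1, by simpa using h2 Finset.univ (by simpa using hsum)⟩
  -- Singletons bound each entry above by `G 1`; their complements bound it below by `G (n + 1) - G
  -- n`.
  have hbdd : ∀ e, P e → e ≤ ∑ _i : Fin (n + 1), (G 1 ^ 2 + (G (n + 1) - G n) ^ 2) := by
    rintro e ⟨u, hu, y, hy, rfl⟩
    obtain ⟨h1, h2⟩ := hyz hu y hy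
    refine Finset.sum_le_sum fun i _ => ?_
    have hi := h1 {i}
    have hi' := h1 (Finset.univ.erase i)
    have h3 := Finset.add_sum_erase Finset.univ y (Finset.mem_univ i)
    rw [Finset.sum_singleton, Finset.card_singleton] at hi
    rw [Finset.card_erase_of_mem (Finset.mem_univ i), Finset.card_univ, Fintype.card_fin,
      Nat.add_sub_cancel] at hi'
    have hlo : G (n + 1) - G n ≤ y i := by linarith
    rcases le_or_gt 0 (y i) with h0 | h0
    · nlinarith [sq_nonneg (G (n + 1) - G n)]
    · nlinarith [sq_nonneg (G 1)]
  obtain ⟨e, ⟨u, hu, y, hy, rfl⟩, hmax⟩ := Int.exists_greatest_of_bdd (P := P)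
    ⟨_, hbdd⟩ ⟨_, v, Relation.ReflTransGen.refl, z, hv, rfl⟩
  refine ⟨u, hu, y, hy, ?_, (hyz hu y hy).2⟩
  -- Two equal entries could be fired, raising the maximal sum of squares.
  have key : ∀ i j, i < j → y i ≠ y j := by
    intro i j hij h
    have := hmax _ ⟨u + eSub i j, hu.tail (centralFires_add_eSub hij (by rw [hy, hy, h])),
      fire y i j, add_eSub_apply_eq_fire hy i j, rfl⟩
    rw [sum_sq_fire y hij.ne h] at this
    omega
  intro i j h
  by_contra hij
  rcases lt_or_gt_of_ne hij with hij | hij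
  · exact key i j hij h
  · exact key j i hij h.symm

theorem isConnectedWeight_of_sum_lt (hv : ∀ i, v.1 i = t + z i) {m : ℕ} (hm : m ≤ n + 1)
    (hsum : ∑ i, z i = ∑ i ∈ Finset.range (n + 1), raisedStair m i)
    (hlt : ∀ S : Finset (Fin (n + 1)), S.Nonempty → S ≠ Finset.univ →
      ∑ k ∈ S, z k < ∑ i ∈ Finset.range S.card, raisedStair m i) :
    (typeA n).IsConnectedWeight v := by
  by_contra hnot
  obtain ⟨i, j, hij⟩ : ∃ i j, eSub i j ∉ (typeA n).firingSpan v := by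
    by_contra! h
    refine hnot (top_le_iff.1 (span_simple.trans (Submodule.span_le.2 ?_)))
    rintro _ ⟨k, rfl⟩
    exact h _ _
  have hlink : ∀ k l, z k = z l → eSub k l ∈ (typeA n).firingSpan v :=
    fun k l hkl => eSub_mem_firingSpan Relation.ReflTransGen.refl (by rw [hv, hv, hkl])
  have hsymm : ∀ k l, eSub k l ∉ (typeA n).firingSpan v → eSub l k ∉ (typeA n).firingSpan v := by
    intro k l h h'
    exact h (by rw [← neg_eSub]; exact Submodule.neg_mem _ h')
  classical
  -- Minimality of the gap leaves no value strictly between `z b` and `z a`: a label there would be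
  -- linked to both, hence link `a` to `b`.
  obtain ⟨⟨a, b⟩, hab, hmin⟩ := Finset.exists_min_image
    (Finset.univ.filter fun p : Fin (n + 1) × Fin (n + 1) =>
      eSub p.1 p.2 ∉ (typeA n).firingSpan v ∧ z p.2 < z p.1) (fun p => z p.1 - z p.2) (by
    rcases lt_trichotomy (z i) (z j) with h | h | h
    · exact ⟨(j, i), by simpa using ⟨hsymm _ _ hij, h⟩⟩
    · exact absurd (hlink _ _ h) hij
    · exact ⟨(i, j), by simpa using ⟨hij, h⟩⟩)
  simp only [Finset.mem_filter, Finset.mem_univ, true_and, Prod.forall] at hab hmin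
  obtain ⟨hab, hba⟩ := hab
  have hgap : ∀ x, z x < z a → z x ≤ z b := by
    intro x hx
    by_contra! hbx
    have h1 : eSub a x ∈ (typeA n).firingSpan v := by
      by_contra h
      have := hmin a x ⟨h, hx⟩
      omega
    have h2 : eSub x b ∈ (typeA n).firingSpan v := by
      by_contra h
      have := hmin x b ⟨h, hbx⟩
      omega
    exact hab (by rw [← eSub_add a x b]; exact Submodule.add_mem _ h1 h2)
  have hstair : ∀ k, k + 2 ≤ n + 1 → ∑ i ∈ Finset.range k, raisedStair m i
      + ∑ i ∈ Finset.range (k + 2), raisedStair m i + 1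
      ≤ 2 * ∑ i ∈ Finset.range (k + 1), raisedStair m i := by
    intro k _
    rw [Finset.sum_range_succ _ (k + 1), Finset.sum_range_succ]
    have := raisedStair_succ_lt m k
    linarith
  obtain ⟨u, hu, y, hy, hinj, hysum⟩ := exists_reachable_injective
    (G := fun k => ∑ i ∈ Finset.range k, raisedStair m i) hv hstair (fun S => by
      rcases S.eq_empty_or_nonempty with rfl | hS
      · simp
      by_cases hS' : S = Finset.univ
      · subst hS'; simp [hsum]
      · exact (hlt S hS hS').le) hsum
  let A : Finset (Fin (n + 1)) := Finset.univ.filter fun x => z a ≤ z x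
  have ha : a ∈ A := by simp [A]
  have hb : b ∉ A := by simpa [A] using hba
  obtain ⟨y', hy', hA, a', b', -, -, -, hab', hmin', hmax'⟩ := exists_separated_of_reachable
    (A := A) hv hab ha hb hba (fun x hx => by simpa [A] using hx)
    (fun x hx => hgap x (by simpa [A] using hx)) hu
  have e : y = y' := funext fun i => by
    have := (hy i).symm.trans (hy' i)
    rwa [add_right_inj, Int.cast_inj] at this
  subst e
  have h1 := sum_raisedStair_le_of_injective hinj (m := m) (by simpa using hm)
    (by simpa using hysum) hab' hmin' hmax'
  have h2 := hlt A ⟨a, ha⟩ (fun h => hb (h ▸ Finset.mem_univ b))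
  omega

theorem isConnectedWeight_iff_mem_interior (hv : ∀ i, v.1 i = t + z i) {w : sumZero n} {m : ℕ}
    (hm : m ≤ n + 1) (hw : ∀ i, w.1 i = t + raisedStair m i) :
    (typeA n).IsConnectedWeight v ↔ v ∈ interior ((typeA n).permutohedron w) := by
  have hanti : Antitone fun k => t + (raisedStair m k : ℝ) := fun a b hab => by
    have := raisedStair_antitone m hab
    simpa using this
  rw [mem_interior_permutohedron_iff (f := fun k => t + (raisedStair m k : ℝ)) hanti hw]
  have hsum : ∑ i, z i = ∑ i ∈ Finset.range (n + 1), raisedStair m i := by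
    rw [← Fin.sum_univ_eq_sum_range]
    have h1 : coordSum Finset.univ v = 0 := sum_coord v
    have h2 : coordSum Finset.univ w = 0 := sum_coord w
    rw [coordSum_eq hv] at h1
    rw [coordSum_eq (z := fun i : Fin (n + 1) => raisedStair m i) hw] at h2
    have := h1.trans h2.symm
    rwa [add_right_inj, Int.cast_inj] at this
  have hiff : ∀ S : Finset (Fin (n + 1)),
      coordSum S v < ∑ i ∈ Finset.range S.card, (t + (raisedStair m i : ℝ)) ↔
        ∑ k ∈ S, z k < ∑ i ∈ Finset.range S.card, raisedStair m i := by
    intro S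
    rw [coordSum_eq hv, Finset.sum_add_distrib, Finset.sum_const, Finset.card_range, nsmul_eq_mul,
      add_lt_add_iff_left, ← Int.cast_sum, Int.cast_lt]
  simp only [hiff]
  constructor
  · intro h S hS hS'
    refine sum_lt_of_isConnectedWeight (R := fun k => ∑ i ∈ Finset.range k, raisedStair m i)
      hv (by simp) (fun k => ?_) hsum h hS hS'
    rw [Finset.sum_range_succ _ (k + 1), Finset.sum_range_succ]
    have := raisedStair_succ_lt m k
    linarith
  · exact isConnectedWeight_of_sum_lt hv hm hsum

end TypeA

/-! ### Minuscule weights and cosets of the root lattice. -/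

namespace TypeA
variable {n : ℕ}

theorem exists_perm_of_card_filter_eq {α : Type*} [Fintype α] (p q : α → Prop) [DecidablePred p]
    [DecidablePred q] (h : (Finset.univ.filter p).card = (Finset.univ.filter q).card) :
    ∃ σ : Equiv.Perm α, ∀ i, q (σ i) ↔ p i := by
  classical
  have e : {x // p x} ≃ {x // q x} := Fintype.equivOfCardEq (by
    rw [Fintype.card_subtype, Fintype.card_subtype, h])
  refine ⟨e.extendSubtype, fun i => ⟨fun hq => ?_, fun hp => e.extendSubtype_mem i hp⟩⟩
  by_contra hp
  exact e.extendSubtype_not_mem i hp hq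

theorem card_filter_val_lt {m : ℕ} (hm : m ≤ n + 1) :
    (Finset.univ.filter fun i : Fin (n + 1) => (i : ℕ) < m).card = m := by
  have : (Finset.univ.filter fun i : Fin (n + 1) => (i : ℕ) < m).image Fin.val
      = Finset.range m := by
    ext a
    simp only [Finset.mem_image, Finset.mem_filter, Finset.mem_univ, true_and, Finset.mem_range]
    constructor
    · rintro ⟨i, hi, rfl⟩; exact hi
    · intro ha; exact ⟨⟨a, by omega⟩, ha, rfl⟩
  rw [← Finset.card_image_of_injective _ Fin.val_injective, this, Finset.card_range]

/-- The coordinates of the `m`-th fundamental weight, and of `0` for `m = 0`. -/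
noncomputable def fundamentalCoord (n m k : ℕ) : ℝ := (if k < m then 1 else 0) - (m : ℝ) / (n + 1)

theorem fundamentalCoord_antitone (n m : ℕ) : Antitone (fundamentalCoord n m) := by
  intro a b hab
  unfold fundamentalCoord
  have : (if b < m then (1 : ℝ) else 0) ≤ if a < m then 1 else 0 := by
    split_ifs <;> first | omega | norm_num
  linarith

theorem fundamentalCoord_sub (n m k l : ℕ) : fundamentalCoord n m k - fundamentalCoord n m l
    = (((if k < m then 1 else 0) - (if l < m then 1 else 0) : ℤ) : ℝ) := by
  unfold fundamentalCoord
  push_cast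
  ring

/-- After adding `m / (n + 1)` the coordinates of a point are integers; the bounds for singletons
and their complements force them into `{0, 1}`, and the zero sum makes exactly `m` of them equal to
`1`. -/
theorem permutohedronPoints_eq_weylOrbit {ω : sumZero n} {m : ℕ} (hm : m ≤ n)
    (hω : ∀ i, ω.1 i = fundamentalCoord n m i) :
    (typeA n).permutohedronPoints ω = (typeA n).weylOrbit ω := by
  ext u
  constructor
  · rintro ⟨hu, hQ⟩
    rw [mem_rootLattice_iff] at hQ
    have hle := coordSum_le_of_mem_permutohedron (fundamentalCoord_antitone n m) hω hu
    have hq : ∀ i, ∃ q : ℤ, u.1 i = q - (m : ℝ) / (n + 1) := by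
      intro i
      obtain ⟨k, hk⟩ := hQ i
      refine ⟨(if (i : ℕ) < m then 1 else 0) - k, ?_⟩
      rw [sub_apply, hω, fundamentalCoord] at hk
      push_cast
      linarith
    choose q hq using hq
    have hsum0 : ∑ i ∈ Finset.range (n + 1), fundamentalCoord n m i = 0 := by
      rw [← Fin.sum_univ_eq_sum_range, ← Finset.sum_congr rfl fun i _ => hω i, sum_coord]
    have hq01 : ∀ i, q i = if q i = 1 then 1 else 0 := by
      intro i
      have h1 := hle {i}
      have h2 := hle (Finset.univ.erase i)
      have h3 := Finset.add_sum_erase Finset.univ (fun k => u.1 k) (Finset.mem_univ i)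
      rw [sum_coord] at h3
      rw [Finset.sum_range_succ] at hsum0
      rw [Finset.card_erase_of_mem (Finset.mem_univ i), Finset.card_univ, Fintype.card_fin,
        Nat.add_sub_cancel, coordSum_apply] at h2
      have hn : fundamentalCoord n m n = -((m : ℝ) / (n + 1)) := by
        rw [fundamentalCoord, if_neg (by omega), zero_sub]
      rw [coordSum_apply, Finset.sum_singleton, Finset.card_singleton, Finset.sum_range_one, hq,
        fundamentalCoord] at h1
      have h4 : (if 0 < m then (1 : ℝ) else 0) ≤ 1 := by split_ifs <;> norm_num
      have h5 : (q i : ℝ) ≤ 1 := by linarith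
      have h6 : (0 : ℝ) ≤ q i := by
        have := hq i
        linarith
      have h7 : q i ≤ 1 := by exact_mod_cast h5
      have h8 : 0 ≤ q i := by exact_mod_cast h6
      split_ifs <;> omega
    have hcard : (Finset.univ.filter fun i => q i = 1).card = m := by
      have h1 := sum_coord u
      rw [Finset.sum_congr rfl fun i _ => hq i, Finset.sum_sub_distrib, ← Int.cast_sum,
        Finset.sum_congr rfl fun i _ => hq01 i] at h1
      simp only [Finset.sum_boole, Finset.sum_const, Finset.card_univ, Fintype.card_fin,
        nsmul_eq_mul] at h1
      push_cast at h1
      rw [mul_div_cancel₀ _ (by positivity : (n : ℝ) + 1 ≠ 0)] at h1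
      exact_mod_cast sub_eq_zero.1 h1
    obtain ⟨σ, hσ⟩ := exists_perm_of_card_filter_eq (fun i => q i = 1)
      (fun i : Fin (n + 1) => (i : ℕ) < m) (by
        rw [hcard, card_filter_val_lt (by omega)])
    refine (mem_weylOrbit_iff _ _).2 ⟨σ, fun i => ?_⟩
    rw [hω, fundamentalCoord, hq, hq01]
    simp only [hσ]
    push_cast
    rfl
  · intro hu
    refine ⟨subset_convexHull ℝ _ hu, (mem_rootLattice_iff _).2 fun i => ?_⟩
    obtain ⟨σ, hσ⟩ := (mem_weylOrbit_iff _ _).1 hu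
    rw [sub_apply, hσ, hω, hω, fundamentalCoord_sub]
    exact ⟨_, rfl⟩

theorem isDominant_iff (x : sumZero n) :
    (typeA n).IsDominant x ↔ Antitone fun i => x.1 i := by
  rw [Fin.antitone_iff_succ_le]
  refine forall_congr' fun i => ?_
  have : (typeA n).simple i = eSub i.castSucc i.succ := simpleBasis_apply i
  rw [this, inner_dualVector_eSub _ Fin.castSucc_lt_succ.ne, sub_nonneg]

theorem mem_minusculeOrZero_of_coord {ω : sumZero n} {m : ℕ} (hm : m ≤ n)
    (hω : ∀ i, ω.1 i = fundamentalCoord n m i) : ω ∈ (typeA n).minusculeOrZero := by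
  rcases Nat.eq_zero_or_pos m with rfl | hpos
  · right
    exact ext_coord fun i => by rw [hω]; simp [fundamentalCoord]
  · left
    refine ⟨(mem_weightLattice_iff _).2 fun i j => ?_, ?_, (isDominant_iff _).2 fun i j hij => ?_,
      permutohedronPoints_eq_weylOrbit hm hω⟩
    · rw [hω, hω, fundamentalCoord_sub]
      exact ⟨_, rfl⟩
    · rintro rfl
      have h := hω 0
      have h0 : (0 : ℝ) = 1 - m / (n + 1) := by
        simpa [fundamentalCoord, hpos] using h
      have h1 : (m : ℝ) / (n + 1) < 1 := by
        rw [div_lt_one (by positivity)]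
        exact_mod_cast Nat.lt_succ_of_le hm
      linarith
    · simp only [hω]
      exact fundamentalCoord_antitone n m hij

/-- A minuscule weight has first and last coordinates at distance at most one. -/
theorem sub_le_one_of_mem_minusculeWeights {ω : sumZero n} (h : ω ∈ (typeA n).minusculeWeights) :
    ω.1 0 - ω.1 (Fin.last n) ≤ 1 := by
  obtain ⟨hP, -, -, hpts⟩ := h
  by_contra! hlt
  have hne : (0 : Fin (n + 1)) ≠ Fin.last n := by
    intro h
    rw [← h, sub_self] at hlt
    norm_num at hlt
  obtain ⟨D, hD⟩ := (mem_weightLattice_iff _).1 hP 0 (Fin.last n)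
  set e : sumZero n := eSub 0 (Fin.last n) with he
  have hDpos : (0 : ℝ) < D := by linarith
  have hs : rootReflection e ω ∈ (typeA n).permutohedron ω :=
    subset_convexHull ℝ _ ⟨_, Subgroup.subset_closure ⟨e, eSub_mem_roots hne, rfl⟩, rfl⟩
  have hω : ω ∈ (typeA n).permutohedron ω :=
    subset_convexHull ℝ _ ⟨1, Subgroup.one_mem _, rfl⟩
  have hmem : ω - e ∈ (typeA n).permutohedron ω := by
    -- The reflection of `ω` is `ω - D e`, so weight `1 / D` on it produces `ω - e`.
    have := (convex_convexHull ℝ ((typeA n).weylOrbit ω)) hω hs (a := 1 - 1 / (D : ℝ))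
      (b := 1 / (D : ℝ)) (by rw [sub_nonneg, div_le_one hDpos]; linarith) (by positivity)
      (by ring)
    rw [rootReflection_apply, he, inner_dualVector_eSub _ hne, hD, smul_sub, smul_smul,
      one_div_mul_cancel hDpos.ne', one_smul, ← add_sub_assoc, ← add_smul,
      sub_add_cancel, one_smul] at this
    exact this
  have hQ : ω - e ∈ (typeA n).permutohedronPoints ω :=
    ⟨hmem, by
      rw [sub_sub_cancel]
      exact AddSubgroup.subset_closure (eSub_mem_roots hne)⟩
  rw [hpts] at hQ
  obtain ⟨w, -, hw⟩ := hQ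
  -- But the squared norm of `ω - e` is that of `ω` plus `2 - 2 D`, which is smaller as `D > 1`.
  have h1 : ⟪ω - e, ω - e⟫ = ⟪ω, ω⟫ := by rw [hw, w.inner_map_map]
  rw [real_inner_sub_sub_self, he, inner_eSub, inner_eSub, eSub_apply, eSub_apply] at h1
  simp only [if_true, if_neg hne, if_neg hne.symm] at h1
  linarith

/-- For nonzero `ω`, the coordinates measured from the last one are integers in `{0, 1}` and
decreasing, so the ones fill an initial segment; its length is `m`, and the zero sum fixes the last
coordinate. -/
theorem exists_coord_of_mem_minusculeOrZero {ω : sumZero n}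
    (h : ω ∈ (typeA n).minusculeOrZero) :
    ∃ m ≤ n, ∀ i, ω.1 i = fundamentalCoord n m i := by
  rcases h with h | rfl
  swap
  · exact ⟨0, Nat.zero_le _, fun i => by simp [fundamentalCoord]⟩
  have hd := sub_le_one_of_mem_minusculeWeights h
  obtain ⟨hP, -, hdom, -⟩ := h
  rw [isDominant_iff] at hdom
  choose q hq using fun i => (mem_weightLattice_iff _).1 hP i (Fin.last n)
  have hq0 : ∀ i, 0 ≤ q i := by
    intro i
    have h1 : ω.1 (Fin.last n) ≤ ω.1 i := hdom (Fin.le_last i)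
    have : (0 : ℝ) ≤ q i := by rw [← hq]; linarith
    exact_mod_cast this
  have hq1 : ∀ i, q i ≤ 1 := by
    intro i
    have h1 : ω.1 i ≤ ω.1 0 := hdom (Fin.zero_le i)
    have : (q i : ℝ) ≤ 1 := by rw [← hq]; linarith
    exact_mod_cast this
  have hanti : Antitone q := by
    intro i j hij
    have h1 : ω.1 j ≤ ω.1 i := hdom hij
    have : (q j : ℝ) ≤ q i := by rw [← hq, ← hq]; linarith
    exact_mod_cast this
  have hlast : q (Fin.last n) = 0 := by
    have := hq (Fin.last n)
    rw [sub_self] at this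
    exact Int.cast_eq_zero.1 this.symm
  let T : Finset (Fin (n + 1)) := Finset.univ.filter fun i => q i = 1
  have hout : ∀ i, i ∉ T → T.card ≤ i := by
    intro i hi
    rw [← Fin.card_Iio i]
    refine Finset.card_le_card fun j hj => Finset.mem_Iio.2 ?_
    by_contra! hij
    have h1 := hanti hij
    simp only [T, Finset.mem_filter, Finset.mem_univ, true_and] at hi hj
    have := hq1 i
    omega
  have hin : ∀ i, i ∈ T → (i : ℕ) < T.card := by
    intro i hi
    rw [← Nat.succ_le_iff, Nat.succ_eq_add_one, ← Fin.card_Iic i]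
    refine Finset.card_le_card fun j hj => ?_
    have h1 := hanti (Finset.mem_Iic.1 hj)
    simp only [T, Finset.mem_filter, Finset.mem_univ, true_and] at hi ⊢
    have := hq1 j
    omega
  have hqT : ∀ i : Fin (n + 1), (q i : ℝ) = if (i : ℕ) < T.card then 1 else 0 := by
    intro i
    by_cases hi : i ∈ T
    · rw [if_pos (hin i hi)]
      simp only [T, Finset.mem_filter, Finset.mem_univ, true_and] at hi
      rw [hi, Int.cast_one]
    · rw [if_neg (hout i hi).not_gt]
      simp only [T, Finset.mem_filter, Finset.mem_univ, true_and] at hi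
      have h0 := hq0 i
      have h1 := hq1 i
      have : q i = 0 := by omega
      rw [this, Int.cast_zero]
  have hTn : T.card ≤ n := hout (Fin.last n) (by simp [T, hlast])
  refine ⟨T.card, hTn, fun i => ?_⟩
  have hωi : ∀ i : Fin (n + 1), ω.1 i = ω.1 (Fin.last n) + if (i : ℕ) < T.card then 1 else 0 := by
    intro i
    rw [← hqT, ← hq]; ring
  have hs := sum_coord ω
  rw [Finset.sum_congr rfl fun i _ => hωi i, Finset.sum_add_distrib, Finset.sum_boole,
    card_filter_val_lt (by omega), Finset.sum_const, Finset.card_univ, Fintype.card_fin,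
    nsmul_eq_mul] at hs
  push_cast at hs
  have hlast' : ω.1 (Fin.last n) = -((T.card : ℝ) / (n + 1)) := by
    rw [← neg_div, eq_div_iff (by positivity)]
    linarith
  rw [hωi, fundamentalCoord, hlast']
  ring

theorem weylVector_add_apply {ω : sumZero n} {m : ℕ}
    (hω : ∀ i, ω.1 i = fundamentalCoord n m i) (i : Fin (n + 1)) :
    ((typeA n).weylVector + ω).1 i
      = ((n : ℝ) / 2 - (m : ℝ) / (n + 1)) + raisedStair m i := by
  rw [add_apply, weylVector_apply, hω, fundamentalCoord, raisedStair]
  push_cast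
  ring

theorem isConnectedWeight_iff_of_sub_mem_rootLattice {v ω : sumZero n}
    (hω : ω ∈ (typeA n).minusculeOrZero)
    (h : (typeA n).weylVector + ω - v ∈ (typeA n).rootLattice) :
    (typeA n).IsConnectedWeight v ↔
      v ∈ interior ((typeA n).permutohedron ((typeA n).weylVector + ω)) := by
  obtain ⟨m, hm, hω⟩ := exists_coord_of_mem_minusculeOrZero hω
  rw [mem_rootLattice_iff] at h
  choose d hd using h
  refine isConnectedWeight_iff_mem_interior (z := fun i => raisedStair m i - d i) (m := m)
    (fun i => ?_) (by omega) (weylVector_add_apply hω)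
  have := hd i
  rw [sub_apply, weylVector_add_apply hω] at this
  push_cast
  linarith

theorem exists_minusculeOrZero_sub_mem_rootLattice {v : sumZero n}
    (hv : v ∈ (typeA n).weightLattice) : ∃ ω ∈ (typeA n).minusculeOrZero,
      (typeA n).weylVector + ω - v ∈ (typeA n).rootLattice := by
  rw [mem_weightLattice_iff] at hv
  choose d hd using fun i => hv i 0
  obtain ⟨B, hB⟩ : ∃ B : ℤ, 2 * B = (n + 1) * n :=
    ⟨∑ i ∈ Finset.range (n + 1), (i : ℤ), by rw [two_mul_sum_range_cast]; push_cast; ring⟩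
  have hB' : 2 * (B : ℝ) = (n + 1) * n := by exact_mod_cast hB
  have hK : ((n : ℝ) + 1) * v.1 0 = -((∑ i, d i : ℤ) : ℝ) := by
    have h1 := sum_coord v
    rw [Finset.sum_congr rfl fun i _ => (sub_eq_iff_eq_add.1 (hd i)), Finset.sum_add_distrib,
      Finset.sum_const, Finset.card_univ, Fintype.card_fin, nsmul_eq_mul] at h1
    push_cast at h1 ⊢
    linarith
  generalize ∑ i, d i = K at hK
  have hN : ((n : ℤ) + 1) ≠ 0 := by omega
  -- The shift `n / 2 - m / (n + 1) - v_0` equals `(B + K - m) / (n + 1)`, so it is an integer for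
  -- `m` the remainder of `B + K`.
  obtain ⟨m, hm⟩ := Int.eq_ofNat_of_zero_le (Int.emod_nonneg (B + K) hN)
  have hmlt := Int.emod_lt_of_pos (B + K) (show (0 : ℤ) < n + 1 by omega)
  have hmn : m ≤ n := by omega
  have hdm := Int.emod_add_mul_ediv (B + K) (n + 1)
  rw [hm] at hdm
  have hdm' : (m : ℝ) + (n + 1) * (((B + K) / (n + 1) : ℤ) : ℝ) = B + K := by exact_mod_cast hdm
  generalize (B + K) / ((n : ℤ) + 1) = c at hdm'
  let ω : sumZero n := ofCoord (fun i => fundamentalCoord n m i) (by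
    simp only [fundamentalCoord]
    rw [Finset.sum_sub_distrib, Finset.sum_boole, card_filter_val_lt (by omega), Finset.sum_const,
      Finset.card_univ, Fintype.card_fin, nsmul_eq_mul]
    push_cast
    rw [mul_div_cancel₀ _ (by positivity : (n : ℝ) + 1 ≠ 0), sub_self])
  have hω : ∀ i, ω.1 i = fundamentalCoord n m i := fun i => rfl
  refine ⟨ω, mem_minusculeOrZero_of_coord hmn hω, (mem_rootLattice_iff _).2 fun i => ?_⟩
  refine ⟨c + raisedStair m i - d i, ?_⟩
  have hc : (n : ℝ) / 2 - (m : ℝ) / (n + 1) - v.1 0 = c := by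
    have hpos : (n : ℝ) + 1 ≠ 0 := by positivity
    field_simp
    linarith
  rw [sub_apply, weylVector_add_apply hω, sub_eq_iff_eq_add.1 (hd i)]
  push_cast
  linarith

theorem eq_of_sub_mem_rootLattice {v ω ω' : sumZero n} (hω : ω ∈ (typeA n).minusculeOrZero)
    (hω' : ω' ∈ (typeA n).minusculeOrZero)
    (h : (typeA n).weylVector + ω - v ∈ (typeA n).rootLattice)
    (h' : (typeA n).weylVector + ω' - v ∈ (typeA n).rootLattice) : ω = ω' := by
  obtain ⟨m, hm, hω⟩ := exists_coord_of_mem_minusculeOrZero hω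
  obtain ⟨m', hm', hω'⟩ := exists_coord_of_mem_minusculeOrZero hω'
  have hsub := AddSubgroup.sub_mem _ h h'
  rw [sub_sub_sub_cancel_right, add_sub_add_left_eq_sub, mem_rootLattice_iff] at hsub
  -- The last coordinates are `-m / (n + 1)` and `-m' / (n + 1)`, so `m` and `m'` agree modulo `n +
  -- 1`; both are at most `n`.
  obtain ⟨k, hk⟩ := hsub (Fin.last n)
  rw [sub_apply, hω, hω', fundamentalCoord, fundamentalCoord, Fin.val_last,
    if_neg (by omega), if_neg (by omega)] at hk
  have hpos : (n : ℝ) + 1 ≠ 0 := by positivity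
  field_simp at hk
  have hk' : (m' : ℤ) - m = (n + 1) * k := by
    have : (m' : ℝ) - m = (n + 1) * k := by linarith
    exact_mod_cast this
  have hk0 : k = 0 := by
    by_contra hne
    rcases lt_or_gt_of_ne hne with h0 | h0
    · nlinarith
    · nlinarith
  rw [hk0, mul_zero] at hk'
  obtain rfl : m = m' := by omega
  exact ext_coord fun i => by rw [hω, hω']

end TypeA

/-! ### The main theorem. -/

open TypeA in
theorem mainTheorem3 (n : ℕ) (v : TypeA.sumZero n) (hv : v ∈ (typeA n).weightLattice) :
    -- there is a unique `ω ∈ Ω_m ∪ {0}` with `ρ + ω - v ∈ Q`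
    (∃! ω, ω ∈ (typeA n).minusculeOrZero ∧
      (typeA n).weylVector + ω - v ∈ (typeA n).rootLattice) ∧
    -- `v` is connected iff `v ∈ Π^{∘,Q}(ρ + ω)` for some `ω ∈ Ω_m ∪ {0}`
    ((typeA n).IsConnectedWeight v ↔
      ∃ ω ∈ (typeA n).minusculeOrZero,
        v ∈ (typeA n).interiorPoints ((typeA n).weylVector + ω)) ∧
    -- equivalently, for the unique `ω` above
    (∀ ω ∈ (typeA n).minusculeOrZero,
      (typeA n).weylVector + ω - v ∈ (typeA n).rootLattice →
        ((typeA n).IsConnectedWeight v ↔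
          v ∈ (typeA n).interiorPoints ((typeA n).weylVector + ω))) := by
  have hex := exists_minusculeOrZero_sub_mem_rootLattice hv
  refine ⟨?_, ⟨fun h => ?_, ?_⟩, fun ω hω hQ => ?_⟩
  · obtain ⟨ω, hω, hQ⟩ := hex
    exact ⟨ω, ⟨hω, hQ⟩, fun ω' h' => eq_of_sub_mem_rootLattice h'.1 hω h'.2 hQ⟩
  · obtain ⟨ω, hω, hQ⟩ := hex
    exact ⟨ω, hω, (isConnectedWeight_iff_of_sub_mem_rootLattice hω hQ).1 h, hQ⟩
  · rintro ⟨ω, hω, hint, hQ⟩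
    exact (isConnectedWeight_iff_of_sub_mem_rootLattice hω hQ).2 hint
  · exact (isConnectedWeight_iff_of_sub_mem_rootLattice hω hQ).trans
      ⟨fun h => ⟨h, hQ⟩, fun h => h.1⟩
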